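/- Let $\mathbb K$ be a field and $m\ge 1$ an integer. **The circle and its representations.** Regard $S^1=\mathbb R/2\pi\mathbb Z$ as a category whose objects are its points and whose morphisms $x\to y$ are the anticlockwise paths $g_{xy}\omega_x^n$, $n\ge 0$, where $g_{xy}$ is the shortest anticlockwise path from $x$ to $y$ (the lazy path if $x=y$) and $\omega_x$ goes from $x$ to $x$ around $S^1$ once. Let $\gamma\colon\mathbb R\to S^1$ be the covering map. A representation of $S^1$ is a functor $M\colon S^1\to\mathrm{Vect}\,\mathbb K$; it is pointwise finite if $\dim M(x)<\infty$ for all $x$. For a bounded interval $U\subseteq\mathbb R$ the string $\overline M_U$ has $\overline M_U(x)$ with basis $\gamma^{-1}(x)\cap U$, and a path of length $d$ sends a basis element $b$ to $b+d$ if $b+d\in U$ and to $0$ otherwise. **Continuous Nakayama representations.** A Kupisch function is a $2\pi$-periodic $\kappa\colon\mathbb R\to\mathbb R_{>0}$ with $t_1+\kappa(t_1)\le t_2+\kappa(t_2)$ whenever $t_1\le t_2$. $\mathrm{Rep}^{\mathrm{pwf}}(S^1,\kappa)$ is the full subcategory of the pointwise finite representations each of whose indecomposable direct summands is isomorphic to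 a string $\overline M_U$ with $U$ a non-empty bounded interval such that $U\subseteq[\inf U,\inf U+\kappa(\inf U)]$. **The $\infty$-gon.** Let $0=p_1<p_2<\dots<p_m<p_{m+1}=2\pi$ and, for $1\le i\le m$, let $(z_{i,n})_{n\in\mathbb Z}$ be a strictly increasing family of reals with $z_{i,n}\to p_i$ as $n\to-\infty$ and $z_{i,n}\to p_{i+1}$ as $n\to+\infty$. Let $\mathcal Z_m$ be the set of all $z_{i,n}$, viewed also in $S^1$, put $z_{i,n}^+=z_{i,n+1}$, and call $p_1,\dots,p_m$ the accumulation points. Let $\kappa$ be the Kupisch function which for $s\in[0,2\pi)$ and $t\equiv s \bmod 2\pi$ is $\kappa(t)=2\pi+z^+-s$ if $s\in[z,z^+)$ for some $z\in\mathcal Z_m$, and $\kappa(t)=2\pi$ if $s$ is an accumulation point. **Infinite discrete symmetric Nakayama representations.** $\mathrm{rep}(\mathcal Z_m,\kappa)$ is the full subcategory of $\mathrm{Rep}^{\mathrm{pwf}}(S^1,\kappa)$ of those $M$ such that 1. $M(g_{xy})$ is an isomorphism for all $x,y\in S^1$ with $z<x\le y\le z^+$ in cyclic order for some $z\in\mathcal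 Z_m$; and 2. for each accumulation point $p$ there are $a,b\in\mathcal Z_m$ with $a<p<b$ in cyclic order such that $M(g_{xy})$ is an isomorphism for all $x,y\in S^1$ with $a<x\le y\le b$ in cyclic order. **Theorem.** The category $\mathrm{rep}(\mathcal Z_m,\kappa)$ is a wide subcategory of the abelian category $\mathrm{Rep}^{\mathrm{pwf}}(S^1,\kappa)$. That is, $\mathrm{Rep}^{\mathrm{pwf}}(S^1,\kappa)$ is abelian, and $\mathrm{rep}(\mathcal Z_m,\kappa)$ contains the zero object, is closed under isomorphisms, finite direct sums and direct summands, and is closed under kernels, cokernels and extensions in $\mathrm{Rep}^{\mathrm{pwf}}(S^1,\kappa)$. In particular $\mathrm{rep}(\mathcal Z_m,\kappa)$ is itself an abelian category. -/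

import Mathlib

open CategoryTheory CategoryTheory.Limits

namespace CircleRep

universe u

/-! ### The circle as a category -/

/-- The circle `ℝ / 2πℤ`, regarded as the set of objects of a category whose morphisms are
the anticlockwise paths. -/
@[ext]
structure Circ : Type where
  angle : Real.Angle

/-- The covering map `γ : ℝ → S¹`, `t ↦ t mod 2π`. -/
noncomputable def cover (t : ℝ) : Circ := ⟨(t : Real.Angle)⟩

/-- The length in `[0, 2π)` of the shortest anticlockwise path from `x` to `y`. -/
noncomputable def arc (x y : Circ) : ℝ :=
  toIcoMod Real.two_pi_pos 0 (y.angle - x.angle).toReal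

/-- An anticlockwise path from `x` to `y`: it is determined by its length `d ≥ 0`,
which has to satisfy `x + d = y` in `ℝ / 2πℤ`. -/
@[ext]
structure Path (x y : Circ) : Type where
  length : ℝ
  nonneg : 0 ≤ length
  target : x.angle + (length : Real.Angle) = y.angle

/-- Composition of paths is concatenation. -/
noncomputable instance : Category Circ where
  Hom := Path
  id x := ⟨0, le_rfl, by simp⟩
  comp f g := ⟨f.length + g.length, add_nonneg f.nonneg g.nonneg, by
    rw [Real.Angle.coe_add, ← add_assoc, f.target, g.target]⟩
  id_comp f := Path.ext (zero_add _)
  comp_id f := Path.ext (add_zero _)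
  assoc f g h := Path.ext (add_assoc _ _ _)

@[simp] lemma id_length (x : Circ) : Path.length (𝟙 x) = 0 := rfl

@[simp] lemma comp_length {x y z : Circ} (f : x ⟶ y) (g : y ⟶ z) :
    Path.length (f ≫ g) = Path.length f + Path.length g := rfl

lemma coe_arc (x y : Circ) :
    ((arc x y : ℝ) : Real.Angle) = y.angle - x.angle := by
  unfold arc
  rw [toIcoMod, Real.Angle.coe_sub, Real.Angle.coe_toReal, zsmul_eq_mul, mul_comm,
    ← zsmul_eq_mul']
  simp

lemma arc_nonneg (x y : Circ) : 0 ≤ arc x y :=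
  left_le_toIcoMod Real.two_pi_pos 0 _

lemma arc_lt (x y : Circ) : arc x y < 2 * Real.pi := by
  simpa [arc] using toIcoMod_lt_right Real.two_pi_pos 0 (y.angle - x.angle).toReal

/-- The shortest anticlockwise path `g_{xy}` from `x` to `y`; `g_{xx}` is the lazy path. -/
noncomputable def g (x y : Circ) : x ⟶ y :=
  (⟨arc x y, arc_nonneg x y, by rw [coe_arc]; abel⟩ : Path x y)

/-- The path `ω_x` from `x` to `x` going round the circle exactly once. -/
noncomputable def loop (x : Circ) : x ⟶ x :=
  (⟨2 * Real.pi, Real.two_pi_pos.le, by simp⟩ : Path x x)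

/-- The iterate `ω_x ^ n`. -/
noncomputable def loopPow (x : Circ) : ℕ → (x ⟶ x)
  | 0 => 𝟙 x
  | n + 1 => loopPow x n ≫ loop x

/-- The morphisms of the category are exactly the paths `g_{xy} ω_x ^ n` with `n ≥ 0`. -/
lemma path_eq (x y : Circ) (f : x ⟶ y) : ∃ n : ℕ, f = loopPow x n ≫ g x y := by
  have hl : ∀ n : ℕ, Path.length (loopPow x n) = n * (2 * Real.pi) := by
    intro n
    induction n with
    | zero => simp [loopPow]
    | succ k ih =>
      rw [loopPow, comp_length, ih]
      have : Path.length (loop x) = 2 * Real.pi := rfl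
      rw [this]; push_cast; ring
  have h1 : ((Path.length f : ℝ) : Real.Angle) = ((arc x y : ℝ) : Real.Angle) := by
    rw [coe_arc]; exact eq_sub_of_add_eq' (Path.target f)
  obtain ⟨k, hk⟩ := Real.Angle.angle_eq_iff_two_pi_dvd_sub.1 h1
  have hf := Path.nonneg f
  have ha := arc_lt x y
  have hpi := Real.two_pi_pos
  have hk0 : 0 ≤ k := by
    by_contra hneg
    have : (k : ℝ) ≤ -1 := by exact_mod_cast (by omega : k ≤ -1)
    nlinarith
  lift k to ℕ using hk0
  refine ⟨k, Path.ext ?_⟩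
  rw [comp_length, hl]
  have : Path.length (g x y) = arc x y := rfl
  rw [this]
  push_cast at hk
  linarith

/-! ### Representations of the circle -/

section Representations

variable (𝕂 : Type u) [Field 𝕂]

/-- Representations of `S¹` over `𝕂`: covariant functors to `𝕂`-vector spaces. -/
abbrev Rep : Type (u + 1) := Circ ⥤ ModuleCat.{u} 𝕂

variable {𝕂}

/-- Pointwise finite representations. -/
def IsPointwiseFinite (M : Rep 𝕂) : Prop := ∀ x : Circ, Module.Finite 𝕂 (M.obj x)

variable (𝕂)

/-- The linear map `𝕂(γ⁻¹(x) ∩ U) → 𝕂(γ⁻¹(y) ∩ U)` given by a path `f : x ⟶ y` of length `d`: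
a basis element `b` is sent to `b + d` if `b + d ∈ U`, and to `0` otherwise. -/
noncomputable def stringMap (U : Set ℝ) {x y : Circ} (f : x ⟶ y) :
    ({b : ℝ // b ∈ U ∧ cover b = x} →₀ 𝕂) →ₗ[𝕂] ({b : ℝ // b ∈ U ∧ cover b = y} →₀ 𝕂) :=
  open Classical in
  Finsupp.linearCombination 𝕂 fun b =>
    if h : b.1 + Path.length f ∈ U then
      Finsupp.single ⟨b.1 + Path.length f, h, by
        have h2 : (b.1 : Real.Angle) = x.angle := congrArg Circ.angle b.2.2
        have h3 := Path.target f
        refine Circ.ext ?_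
        change ((b.1 + Path.length f : ℝ) : Real.Angle) = y.angle
        rw [Real.Angle.coe_add, h2]
        exact h3⟩ 1
    else 0

lemma stringMap_single_of_mem (U : Set ℝ) {x y : Circ} (f : x ⟶ y)
    (b : {b : ℝ // b ∈ U ∧ cover b = x}) (c : {b : ℝ // b ∈ U ∧ cover b = y})
    (h : c.1 = b.1 + Path.length f) :
    stringMap 𝕂 U f (Finsupp.single b 1) = Finsupp.single c 1 := by
  have hm : b.1 + Path.length f ∈ U := h ▸ c.2.1
  rw [stringMap, Finsupp.linearCombination_single, one_smul, dif_pos hm]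
  congr 1
  exact Subtype.ext h.symm

lemma stringMap_single_of_notMem (U : Set ℝ) {x y : Circ} (f : x ⟶ y)
    (b : {b : ℝ // b ∈ U ∧ cover b = x}) (h : b.1 + Path.length f ∉ U) :
    stringMap 𝕂 U f (Finsupp.single b 1) = 0 := by
  rw [stringMap, Finsupp.linearCombination_single, one_smul, dif_neg h]

lemma stringMap_id (U : Set ℝ) (x : Circ) : stringMap 𝕂 U (𝟙 x) = LinearMap.id := by
  refine Finsupp.lhom_ext' fun b => LinearMap.ext_ring ?_
  exact stringMap_single_of_mem 𝕂 U (𝟙 x) b b (by simp)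

lemma stringMap_comp (U : Set ℝ) (hU : U.OrdConnected) {x y z : Circ} (f : x ⟶ y) (k : y ⟶ z) :
    stringMap 𝕂 U (f ≫ k) = stringMap 𝕂 U k ∘ₗ stringMap 𝕂 U f := by
  refine Finsupp.lhom_ext' fun b => LinearMap.ext_ring ?_
  change stringMap 𝕂 U (f ≫ k) (Finsupp.single b 1) =
    stringMap 𝕂 U k (stringMap 𝕂 U f (Finsupp.single b 1))
  have hxy : cover (b.1 + Path.length f) = y := by
    have h2 : (b.1 : Real.Angle) = x.angle := congrArg Circ.angle b.2.2
    have h3 := Path.target f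
    refine Circ.ext ?_
    change ((b.1 + Path.length f : ℝ) : Real.Angle) = y.angle
    rw [Real.Angle.coe_add, h2]
    exact h3
  by_cases h1 : b.1 + Path.length f ∈ U
  · rw [stringMap_single_of_mem 𝕂 U f b ⟨_, h1, hxy⟩ rfl]
    by_cases h2 : b.1 + Path.length f + Path.length k ∈ U
    · have hz : cover (b.1 + Path.length f + Path.length k) = z := by
        have h2 : ((b.1 + Path.length f : ℝ) : Real.Angle) = y.angle := congrArg Circ.angle hxy
        have h3 := Path.target k
        refine Circ.ext ?_
        change ((b.1 + Path.length f + Path.length k : ℝ) : Real.Angle) = z.angle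
        rw [Real.Angle.coe_add, h2]
        exact h3
      rw [stringMap_single_of_mem 𝕂 U k _ ⟨_, h2, hz⟩ rfl,
        stringMap_single_of_mem 𝕂 U (f ≫ k) b ⟨_, h2, hz⟩ (by simp [add_assoc])]
    · rw [stringMap_single_of_notMem 𝕂 U k _ h2,
        stringMap_single_of_notMem 𝕂 U (f ≫ k) b (by simpa [add_assoc] using h2)]
  · rw [stringMap_single_of_notMem 𝕂 U f b h1, map_zero]
    refine stringMap_single_of_notMem 𝕂 U (f ≫ k) b fun h2 => h1 ?_
    have hf := Path.nonneg f
    have hk := Path.nonneg k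
    rw [comp_length] at h2
    exact hU.out b.2.1 h2 ⟨by linarith, by linarith⟩

/-- The string representation `M̄_U` attached to an interval `U` of `ℝ`. -/
noncomputable def string (U : Set ℝ) (hU : U.OrdConnected) : Rep 𝕂 where
  obj x := ModuleCat.of 𝕂 ({b : ℝ // b ∈ U ∧ cover b = x} →₀ 𝕂)
  map f := ModuleCat.ofHom (stringMap 𝕂 U f)
  map_id x := by rw [stringMap_id]; rfl
  map_comp f k := by rw [stringMap_comp 𝕂 U hU]; rfl

variable {𝕂}

/-- `N` is a direct summand of `M`. -/
def IsDirectSummand (N M : Rep 𝕂) : Prop := ∃ N' : Rep 𝕂, Nonempty (M ≅ N ⊞ N')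

end Representations

/-! ### Continuous Nakayama representations -/

/-- Kupisch functions `κ : ℝ → ℝ_{>0}`. -/
structure KupischFunction where
  toFun : ℝ → ℝ
  pos : ∀ t, 0 < toFun t
  periodic : ∀ t, toFun (t + 2 * Real.pi) = toFun t
  add_le_add : ∀ t₁ t₂, t₁ ≤ t₂ → t₁ + toFun t₁ ≤ t₂ + toFun t₂

/-- A pointwise finite representation is a continuous Nakayama representation of `(S¹, κ)` if
each of its indecomposable direct summands is a string `M̄_U` with `U` a bounded interval
contained in `[inf U, inf U + κ (inf U)]`. -/
def IsNakayama (𝕂 : Type u) [Field 𝕂] (κ : KupischFunction) : ObjectProperty (Rep 𝕂) :=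
  fun M => IsPointwiseFinite M ∧
    ∀ N : Rep 𝕂, IsDirectSummand N M → Indecomposable N →
      ∃ (U : Set ℝ) (hU : U.OrdConnected), U.Nonempty ∧ Bornology.IsBounded U ∧
        U ⊆ Set.Icc (sInf U) (sInf U + κ.toFun (sInf U)) ∧ Nonempty (N ≅ string 𝕂 U hU)

/-- The category `Rep^pwf(S¹, κ)` of continuous Nakayama representations. -/
abbrev NakayamaRep (𝕂 : Type u) [Field 𝕂] (κ : KupischFunction) : Type (u + 1) :=
  (IsNakayama 𝕂 κ).FullSubcategory

/-! ### The `∞`-gon -/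

/-- An `∞`-gon `𝒵_m`: `m` copies of `ℤ` embedded in the circle, cut open to `[0, 2π)`, with `m`
two-sided accumulation points. The accumulation points are
`0 = acc 0 < acc 1 < ⋯ < acc (m - 1)`, together with `acc m = 2π` which is again the point `acc 0`
of the circle; the `p`-th copy of `ℤ` increases from `acc p` to `acc (p + 1)`. -/
structure InfinityGon (m : ℕ) where
  acc : Fin (m + 1) → ℝ
  acc_zero : acc 0 = 0
  acc_last : acc (Fin.last m) = 2 * Real.pi
  acc_strictMono : StrictMono acc
  pt : Fin m → ℤ → ℝ
  pt_strictMono : ∀ p, StrictMono (pt p)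
  tendsto_atBot : ∀ p, Filter.Tendsto (pt p) Filter.atBot (nhds (acc p.castSucc))
  tendsto_atTop : ∀ p, Filter.Tendsto (pt p) Filter.atTop (nhds (acc p.succ))

namespace InfinityGon

variable {m : ℕ} (Z : InfinityGon m)

lemma acc_lt_pt (p : Fin m) (n : ℤ) : Z.acc p.castSucc < Z.pt p n :=
  lt_of_le_of_lt ((Z.pt_strictMono p).monotone.le_of_tendsto (Z.tendsto_atBot p) (n - 1))
    (Z.pt_strictMono p (by omega))

lemma pt_lt_acc (p : Fin m) (n : ℤ) : Z.pt p n < Z.acc p.succ :=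
  lt_of_lt_of_le (Z.pt_strictMono p (by omega : n < n + 1))
    ((Z.pt_strictMono p).monotone.ge_of_tendsto (Z.tendsto_atTop p) (n + 1))

/-- `next s = z⁺` if `s ∈ [z, z⁺)` for some vertex `z`, and `next s = s` if there is no such `z`;
for `s ∈ [0, 2π)` the latter means that `s` is an accumulation point. -/
noncomputable def next (s : ℝ) : ℝ :=
  open Classical in
  if h : ∃ q : Fin m × ℤ, s ∈ Set.Ico (Z.pt q.1 q.2) (Z.pt q.1 (q.2 + 1)) then
    Z.pt h.choose.1 (h.choose.2 + 1)
  else s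

lemma next_eq {s : ℝ} {p : Fin m} {n : ℤ} (h : s ∈ Set.Ico (Z.pt p n) (Z.pt p (n + 1))) :
    Z.next s = Z.pt p (n + 1) := by
  have hex : ∃ q : Fin m × ℤ, s ∈ Set.Ico (Z.pt q.1 q.2) (Z.pt q.1 (q.2 + 1)) := ⟨(p, n), h⟩
  rw [next, dif_pos hex]
  obtain ⟨h1, h2⟩ := hex.choose_spec
  generalize hex.choose = q at h1 h2
  obtain ⟨q, k⟩ := q
  dsimp only at h1 h2 ⊢
  have key : ∀ (a b : Fin m) (i j : ℤ), Z.pt a i ≤ s → s < Z.pt a (i + 1) →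
      Z.pt b j ≤ s → s < Z.pt b (j + 1) → ¬ a < b := by
    intro a b i j _ ha hb _ hab
    have h3 : Z.acc a.succ ≤ Z.acc b.castSucc :=
      Z.acc_strictMono.monotone (by rw [Fin.le_def]; simp; omega)
    have h4 := Z.pt_lt_acc a (i + 1)
    have h5 := Z.acc_lt_pt b j
    linarith
  have hqp : q = p := by
    rcases lt_trichotomy q p with hlt | heq | hgt
    · exact (key q p k n h1 h2 h.1 h.2 hlt).elim
    · exact heq
    · exact (key p q n k h.1 h.2 h1 h2 hgt).elim
  subst hqp
  have h3 := (Z.pt_strictMono q).lt_iff_lt.1 (lt_of_le_of_lt h1 h.2)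
  have h4 := (Z.pt_strictMono q).lt_iff_lt.1 (lt_of_le_of_lt h.1 h2)
  rw [show k = n by omega]

lemma next_eq_self {s : ℝ}
    (h : ¬ ∃ q : Fin m × ℤ, s ∈ Set.Ico (Z.pt q.1 q.2) (Z.pt q.1 (q.2 + 1))) :
    Z.next s = s := by
  rw [next, dif_neg h]

lemma le_next (s : ℝ) : s ≤ Z.next s := by
  by_cases h : ∃ q : Fin m × ℤ, s ∈ Set.Ico (Z.pt q.1 q.2) (Z.pt q.1 (q.2 + 1))
  · obtain ⟨q, hq⟩ := h
    rw [Z.next_eq hq]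
    exact hq.2.le
  · rw [Z.next_eq_self h]

lemma next_le {s : ℝ} (hs : s ≤ 2 * Real.pi) : Z.next s ≤ 2 * Real.pi := by
  by_cases h : ∃ q : Fin m × ℤ, s ∈ Set.Ico (Z.pt q.1 q.2) (Z.pt q.1 (q.2 + 1))
  · obtain ⟨q, hq⟩ := h
    rw [Z.next_eq hq, ← Z.acc_last]
    exact (Z.pt_lt_acc q.1 (q.2 + 1)).le.trans (Z.acc_strictMono.monotone (Fin.le_last _))
  · rwa [Z.next_eq_self h]

lemma next_mono {s t : ℝ} (hst : s ≤ t) : Z.next s ≤ Z.next t := by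
  by_cases h : ∃ q : Fin m × ℤ, s ∈ Set.Ico (Z.pt q.1 q.2) (Z.pt q.1 (q.2 + 1))
  · obtain ⟨q, hq⟩ := h
    rw [Z.next_eq hq]
    by_cases ht : t < Z.pt q.1 (q.2 + 1)
    · rw [Z.next_eq (s := t) ⟨hq.1.trans hst, ht⟩]
    · exact (not_lt.1 ht).trans (Z.le_next t)
  · rw [Z.next_eq_self h]
    exact hst.trans (Z.le_next t)

/-- The Kupisch function of `𝒵_m`: if `s ∈ [0, 2π)` is the representative of `t` modulo `2π`,
then `κ(t) = 2π + z⁺ - s` if `s ∈ [z, z⁺)` for a vertex `z`, and `κ(t) = 2π` if `s` is an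
accumulation point. -/
noncomputable def kupisch : KupischFunction where
  toFun t := 2 * Real.pi + Z.next (toIcoMod Real.two_pi_pos 0 t) - toIcoMod Real.two_pi_pos 0 t
  pos t := by
    have := Z.le_next (toIcoMod Real.two_pi_pos 0 t)
    have := Real.two_pi_pos
    linarith
  periodic t := by simp only [toIcoMod_add_right]
  add_le_add t₁ t₂ h := by
    have e₁ := toIcoMod_add_toIcoDiv_zsmul Real.two_pi_pos 0 t₁
    have e₂ := toIcoMod_add_toIcoDiv_zsmul Real.two_pi_pos 0 t₂
    have a₁ := toIcoMod_lt_right Real.two_pi_pos 0 t₁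
    have a₂ := toIcoMod_lt_right Real.two_pi_pos 0 t₂
    have b₁ := left_le_toIcoMod Real.two_pi_pos 0 t₁
    have b₂ := left_le_toIcoMod Real.two_pi_pos 0 t₂
    generalize toIcoMod Real.two_pi_pos 0 t₁ = s₁ at *
    generalize toIcoMod Real.two_pi_pos 0 t₂ = s₂ at *
    generalize toIcoDiv Real.two_pi_pos 0 t₁ = k₁ at *
    generalize toIcoDiv Real.two_pi_pos 0 t₂ = k₂ at *
    rw [zsmul_eq_mul] at e₁ e₂
    have hpi := Real.two_pi_pos
    have hk : k₁ ≤ k₂ := by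
      by_contra hlt
      have : (k₂ : ℝ) + 1 ≤ k₁ := by exact_mod_cast (by omega : k₂ + 1 ≤ k₁)
      nlinarith
    rcases hk.eq_or_lt with rfl | hlt
    · have := Z.next_mono (s := s₁) (t := s₂) (by linarith)
      linarith
    · have h1 : (k₁ : ℝ) + 1 ≤ k₂ := by exact_mod_cast hlt
      have h2 := Z.next_le (s := s₁) (by linarith)
      have h3 := Z.le_next s₂
      nlinarith

end InfinityGon

/-! ### Infinite discrete symmetric Nakayama representations -/

/-- `a < x ≤ y ≤ b` in the cyclic order: going anticlockwise from `a`, one meets `x` (after a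
positive distance), then `y` (possibly equal to `x`), then `b` (possibly equal to `y`), within
one turn. -/
def CyclicLTLELE (a x y b : Circ) : Prop :=
  0 < arc a x ∧ arc a x ≤ arc a y ∧ arc a y ≤ arc a b

/-- `a < x < b` in the cyclic order. -/
def CyclicLTLT (a x b : Circ) : Prop :=
  0 < arc a x ∧ arc a x < arc a b

/-- Infinite discrete symmetric Nakayama representations: the continuous Nakayama representations
`M` of `(S¹, κ)` such that `M(g_{xy})` is invertible
* whenever `z < x ≤ y ≤ z⁺` in the cyclic order, for a vertex `z`, and
* for each accumulation point `p`, whenever `a < x ≤ y ≤ b` in the cyclic order, for some vertices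
  `a` and `b` with `a < p < b` in the cyclic order. -/
def IsDiscreteNakayama (𝕂 : Type u) [Field 𝕂] {m : ℕ} (Z : InfinityGon m) :
    ObjectProperty (NakayamaRep 𝕂 Z.kupisch) := fun M =>
  (∀ (p : Fin m) (n : ℤ) (x y : Circ),
    CyclicLTLELE (cover (Z.pt p n)) x y (cover (Z.pt p (n + 1))) → IsIso (M.obj.map (g x y))) ∧
  (∀ p : Fin m, ∃ (p₁ p₂ : Fin m) (n₁ n₂ : ℤ),
    CyclicLTLT (cover (Z.pt p₁ n₁)) (cover (Z.acc p.castSucc)) (cover (Z.pt p₂ n₂)) ∧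
    ∀ x y : Circ, CyclicLTLELE (cover (Z.pt p₁ n₁)) x y (cover (Z.pt p₂ n₂)) →
      IsIso (M.obj.map (g x y)))

end CircleRep

/-! ### Wide subcategories -/

/-- The full subcategory of `A` given by `P` is a wide subcategory of the abelian category `A`:
it is an additive subcategory (it contains a zero object and is closed under isomorphisms, finite
direct sums and direct summands), and it is closed under kernels, cokernels and extensions. -/
structure IsWideSubcategory {A : Type*} [Category A] [HasZeroMorphisms A]
    (P : ObjectProperty A) : Prop where
  abelian : Nonempty (Abelian A)
  containsZero : P.ContainsZero
  closedUnderIsomorphisms : P.IsClosedUnderIsomorphisms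
  closedUnderFiniteDirectSums : P.IsClosedUnderFiniteProducts
  closedUnderDirectSummands : P.IsStableUnderRetracts
  closedUnderKernels : P.IsClosedUnderKernels
  closedUnderCokernels : P.IsClosedUnderCokernels
  closedUnderExtensions : P.IsClosedUnderExtensions

/-!
# Infinite discrete symmetric Nakayama representations form a wide subcategory

Membership in `Rep^pwf(S¹, κ)` is defined through indecomposable summands, which says little about
subobjects and quotients. The core of the proof is that, for a right continuous Kupisch function,
it is equivalent to a vanishing condition (`isNakayama_eq_vanishesBeyond`): the representation is
pointwise finite, and each path starting at `t` and longer than `κ t` acts as zero. This condition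
clearly passes to subobjects, quotients and finite products, so `Rep^pwf(S¹, κ)` is an abelian
subcategory of all representations, with exact evaluation functors.

*Vanishing implies Nakayama.* Let `N` be indecomposable and satisfy the vanishing condition. Its
pullback along the covering map is a persistence module over `ℝ`, and such a module has an interval
summand (`exists_interval_summand`): in one non-zero space `V t₀`, take a vector in the smallest
non-zero image but outside the largest kernel not containing that image, and a functional
separating it from this kernel; the vector lifts to the left and the functional extends to the
right. By the vanishing condition the support `U` of the summand is bounded. Pushing down, the
string of `U` is a retract of `N`, since the resulting endomorphism of the string is unitriangular
(`exists_isIso_string_comp`), and so it is isomorphic to `N`. Right continuity gives the bound by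
`κ` at the infimum of `U`.

*Nakayama implies vanishing.* If a path acts non-trivially on a pointwise finite representation, it
does so on an indecomposable summand (`exists_indecomposable_summand`, by Zorn's lemma for
idempotents), and on strings bounded by `κ` the long paths vanish.

Finally, for a fixed path `f : x ⟶ y`, the objects on which `f` acts invertibly are those at which
a transformation between two exact functors is invertible, and these are closed under kernels,
cokernels, extensions, finite products and retracts. Two members of `rep(𝒵_m, κ)` may use different
arcs around the accumulation points, but smaller arcs serve both
(`IsDiscreteNakayama.exists_inverts`).
-/

namespace CircleRep

universe u

/-! ### Interval summands of persistence modules -/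

section PersistenceModules

variable {𝕂 : Type*} [Field 𝕂] {ι : Type*} [LinearOrder ι]

/-- A functional on one term of a direct system of vector spaces that kills every kernel of the
system extends compatibly to all terms: it factors through the image in the direct limit, and a
functional on a subspace extends. -/
theorem exists_compatible_functionals {G : ι → Type*} [∀ i, AddCommGroup (G i)]
    [∀ i, Module 𝕂 (G i)] (f : ∀ i j, i ≤ j → G i →ₗ[𝕂] G j)
    [DirectedSystem G fun i j h => f i j h] (i₀ : ι) (ξ : G i₀ →ₗ[𝕂] 𝕂)
    (hξ : ∀ j (h : i₀ ≤ j) x, f i₀ j h x = 0 → ξ x = 0) :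
    ∃ η : ∀ i, G i →ₗ[𝕂] 𝕂, η i₀ = ξ ∧ ∀ i j h x, η j (f i j h x) = η i x := by
  classical
  have : Nonempty ι := ⟨i₀⟩
  have hker : ξ ∈ (LinearMap.ker (Module.DirectLimit.of 𝕂 ι G f i₀)).dualAnnihilator := by
    rw [Submodule.mem_dualAnnihilator]
    intro x hx
    obtain ⟨j, h, hj⟩ := Module.DirectLimit.of.zero_exact hx
    exact hξ j h x hj
  rw [← LinearMap.range_dualMap_eq_dualAnnihilator_ker] at hker
  obtain ⟨φ, hφ⟩ := hker
  refine ⟨fun i => φ ∘ₗ Module.DirectLimit.of 𝕂 ι G f i, hφ, fun i j h x => ?_⟩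
  simp [Module.DirectLimit.of_f]

/-- Dual form of `exists_compatible_functionals`: a vector lying in the image of every transition
map lifts to a compatible family. Finite dimension lets vectors be read as functionals on the dual
spaces, which form a direct system for the reversed order. -/
theorem exists_compatible_vectors {G : ι → Type*} [∀ i, AddCommGroup (G i)]
    [∀ i, Module 𝕂 (G i)] [∀ i, FiniteDimensional 𝕂 (G i)]
    (f : ∀ i j, i ≤ j → G i →ₗ[𝕂] G j)
    [DirectedSystem G fun i j h => f i j h] (i₀ : ι) (v : G i₀)
    (hv : ∀ j (h : j ≤ i₀), v ∈ LinearMap.range (f j i₀ h)) :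
    ∃ w : ∀ i, G i, w i₀ = v ∧ ∀ i j h, f i j h (w i) = w j := by
  let F : ∀ i j : ιᵒᵈ, i ≤ j → Module.Dual 𝕂 (G i.ofDual) →ₗ[𝕂] Module.Dual 𝕂 (G j.ofDual) :=
    fun i j h => (f j.ofDual i.ofDual h).dualMap
  have : DirectedSystem (fun i : ιᵒᵈ => Module.Dual 𝕂 (G i.ofDual)) fun i j h => F i j h :=
    ⟨fun i x => LinearMap.ext fun y =>
        congrArg x (DirectedSystem.map_self (f := fun i j h => f i j h) y),
      fun i j k h₁ h₂ x => LinearMap.ext fun y =>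
        congrArg x (DirectedSystem.map_map (f := fun i j h => f i j h) h₂ h₁ y)⟩
  obtain ⟨η, h₀, hη⟩ := exists_compatible_functionals F (OrderDual.toDual i₀)
    (Module.Dual.eval 𝕂 (G i₀) v) (by
      intro j h x hx
      obtain ⟨y, rfl⟩ := hv j.ofDual h
      exact LinearMap.congr_fun hx y)
  have hw : ∀ i, ∃ w : G i, ∀ φ : Module.Dual 𝕂 (G i), η (OrderDual.toDual i) φ = φ w := by
    intro i
    refine ⟨(Module.evalEquiv 𝕂 (G i)).symm (η (OrderDual.toDual i)), fun φ => ?_⟩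
    exact (Module.apply_evalEquiv_symm_apply 𝕂 (G i) φ (η (OrderDual.toDual i))).symm
  choose w hw using hw
  refine ⟨w, ?_, fun i j h => ?_⟩
  · refine Module.eval_apply_injective 𝕂 (LinearMap.ext fun φ => ?_)
    exact (hw i₀ φ).symm.trans (LinearMap.congr_fun h₀ φ)
  · refine Module.eval_apply_injective 𝕂 (LinearMap.ext fun φ => ?_)
    have h₁ := hη (OrderDual.toDual j) (OrderDual.toDual i) h φ
    exact (hw i _).symm.trans (h₁.trans (hw j φ))

/-- Every non-zero pointwise finite-dimensional persistence module `V` over a linear order has an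
interval summand. It is given by its support `U`, a family `v` spanning the summand, and a family
`ξ` of functionals projecting onto it; both families are extended by zero outside `U`. -/
theorem exists_interval_summand {V : ι → Type*} [∀ i, AddCommGroup (V i)]
    [∀ i, Module 𝕂 (V i)] [∀ i, FiniteDimensional 𝕂 (V i)]
    (T : ∀ i j, i ≤ j → V i →ₗ[𝕂] V j)
    [DirectedSystem V fun i j h => T i j h] (t₀ : ι) [Nontrivial (V t₀)] :
    ∃ (U : Set ι) (v : ∀ t, V t) (ξ : ∀ t, V t →ₗ[𝕂] 𝕂), t₀ ∈ U ∧
      (∀ t ∈ U, ∀ t' (h : t ≤ t'), T t t' h (v t) = v t') ∧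
      (∀ t' ∈ U, ∀ t (h : t ≤ t') x, ξ t' (T t t' h x) = ξ t x) ∧
      (∀ t ∉ U, v t = 0) ∧ (∀ t ∉ U, ξ t = 0) ∧ ∀ t ∈ U, ξ t (v t) = 1 := by
  classical
  have hTid : ∀ i (x : V i), T i i le_rfl x = x :=
    fun i x => DirectedSystem.map_self (f := fun i j h => T i j h) x
  have hTT : ∀ i j k (h : i ≤ j) (h' : j ≤ k) (x : V i),
      T j k h' (T i j h x) = T i k (h.trans h') x :=
    fun i j k h h' x => DirectedSystem.map_map (f := fun i j h => T i j h) h h' x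
  -- The images of the maps into `V t₀` form a chain, whose smallest non-zero member `I` exists
  -- by finite dimension; `L` is the part of the support below `t₀`.
  let L : Type _ := {s : ι // ∃ h : s ≤ t₀, T s t₀ h ≠ 0}
  have hLt₀ : ∃ h : t₀ ≤ t₀, T t₀ t₀ h ≠ 0 := by
    obtain ⟨x, hx⟩ := exists_ne (0 : V t₀)
    exact ⟨le_rfl, fun h => hx (by rw [← hTid t₀ x, h]; rfl)⟩
  have : Nonempty L := ⟨⟨t₀, hLt₀⟩⟩
  obtain ⟨s₀, hs₀⟩ : ∃ s₀ : L, ∀ s : L,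
      LinearMap.range (T s₀.1 t₀ s₀.2.1) ≤ LinearMap.range (T s.1 t₀ s.2.1) := by
    refine ⟨Function.argmin
      (fun s : L => Module.finrank 𝕂 (LinearMap.range (T s.1 t₀ s.2.1))), fun s => ?_⟩
    set s₀ := Function.argmin
      (fun s : L => Module.finrank 𝕂 (LinearMap.range (T s.1 t₀ s.2.1))) with hs₀
    have hmono : ∀ a b : L, a.1 ≤ b.1 →
        LinearMap.range (T a.1 t₀ a.2.1) ≤ LinearMap.range (T b.1 t₀ b.2.1) := by
      rintro a b hab _ ⟨x, rfl⟩
      exact ⟨T a.1 b.1 hab x, hTT _ _ _ _ _ _⟩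
    rcases le_total s₀.1 s.1 with h | h
    · exact hmono _ _ h
    · exact (Submodule.eq_of_le_of_finrank_le (hmono _ _ h)
        (Function.argmin_le
          (fun s : L => Module.finrank 𝕂 (LinearMap.range (T s.1 t₀ s.2.1))) s)).ge
  set I := LinearMap.range (T s₀.1 t₀ s₀.2.1) with hI
  have hI0 : ∃ x ∈ I, x ≠ 0 := by
    obtain ⟨x, hx⟩ := not_forall.1 fun h => s₀.2.2 (LinearMap.ext h)
    exact ⟨_, ⟨x, rfl⟩, hx⟩
  -- Similarly for the kernels of the maps out of `V t₀`: `r₀` gives the largest kernel that does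
  -- not contain `I`, and `R` is the part of the support above `t₀`.
  let R : Type _ := {t : ι // ∃ h : t₀ ≤ t, ∃ x ∈ I, T t₀ t h x ≠ 0}
  have hRt₀ : ∃ h : t₀ ≤ t₀, ∃ x ∈ I, T t₀ t₀ h x ≠ 0 := by
    obtain ⟨x, hx, hx0⟩ := hI0
    exact ⟨le_rfl, x, hx, by rwa [hTid]⟩
  have : Nonempty R := ⟨⟨t₀, hRt₀⟩⟩
  obtain ⟨r₀, hr₀⟩ : ∃ r₀ : R, ∀ r : R,
      LinearMap.ker (T t₀ r.1 r.2.1) ≤ LinearMap.ker (T t₀ r₀.1 r₀.2.1) := by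
    have hmono : ∀ a b : R, a.1 ≤ b.1 →
        LinearMap.ker (T t₀ a.1 a.2.1) ≤ LinearMap.ker (T t₀ b.1 b.2.1) := by
      intro a b hab x hx
      rw [LinearMap.mem_ker] at hx ⊢
      rw [← hTT t₀ a.1 b.1 a.2.1 hab, hx, map_zero]
    let d : R → ℕ := fun r => Module.finrank 𝕂 (LinearMap.range (T t₀ r.1 r.2.1))
    have hd : ∀ r : R, d r + Module.finrank 𝕂 (LinearMap.ker (T t₀ r.1 r.2.1)) =
      Module.finrank 𝕂 (V t₀) := fun r => LinearMap.finrank_range_add_finrank_ker _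
    refine ⟨Function.argmin d, fun r => ?_⟩
    set r₀ := Function.argmin d
    rcases le_total r.1 r₀.1 with h | h
    · exact hmono _ _ h
    · have h1 : d r₀ ≤ d r := Function.argmin_le d r
      have h2 := hd r
      have h3 := hd r₀
      exact (Submodule.eq_of_le_of_finrank_le (hmono _ _ h) (by omega)).ge
  -- A vector of `I` outside the largest kernel, and a functional separating it from that kernel.
  obtain ⟨v, hvI, hvK⟩ := r₀.2.2
  obtain ⟨ξ₁, hξv, hξK⟩ := Submodule.exists_le_ker_of_notMem
    (p := LinearMap.ker (T t₀ r₀.1 r₀.2.1)) (v := v) hvK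
  obtain ⟨ξ₀, hξ₀v, hξ₀⟩ : ∃ ξ₀ : V t₀ →ₗ[𝕂] 𝕂, ξ₀ v = 1 ∧
      ∀ r : R, ∀ x, T t₀ r.1 r.2.1 x = 0 → ξ₀ x = 0 :=
    ⟨(ξ₁ v)⁻¹ • ξ₁, by simp [hξv], fun r x hx => by
      have : ξ₁ x = 0 := hξK (hr₀ r hx)
      simp [this]⟩
  -- Since `v` lies in `I`, it lifts compatibly to all `V s` with `s` in `L`.
  have : DirectedSystem (fun s : L => V s.1) fun s s' h => T s.1 s'.1 h :=
    ⟨fun s x => hTid _ _, fun s s' s'' h h' x => hTT _ _ _ _ _ _⟩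
  obtain ⟨w, hw₀, hw⟩ := exists_compatible_vectors (fun s s' : L => T s.1 s'.1)
    ⟨t₀, hLt₀⟩ v (fun s h => hs₀ s hvI)
  -- Since `ξ₀` kills the largest kernel, it extends compatibly to all `V t` with `t` in `R`.
  have : DirectedSystem (fun s : R => V s.1) fun s s' h => T s.1 s'.1 h :=
    ⟨fun s x => hTid _ _, fun s s' s'' h h' x => hTT _ _ _ _ _ _⟩
  obtain ⟨η, hη₀, hη⟩ := exists_compatible_functionals (fun s s' : R => T s.1 s'.1)
    ⟨t₀, hRt₀⟩ ξ₀ (fun t h x hx => hξ₀ t x hx)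
  have hLup : ∀ s t (h : s ≤ t) (ht : t ≤ t₀), T s t₀ (h.trans ht) ≠ 0 → T t t₀ ht ≠ 0 := by
    intro s t h ht hs h0
    refine hs (LinearMap.ext fun x => ?_)
    rw [← hTT _ _ _ h ht, h0]
    rfl
  have hRdown : ∀ s t (h : s ≤ t) (hs : t₀ ≤ s),
      (∃ x ∈ I, T t₀ t (hs.trans h) x ≠ 0) → ∃ x ∈ I, T t₀ s hs x ≠ 0 := by
    rintro s t h hs ⟨x, hx, hx0⟩
    refine ⟨x, hx, fun h0 => hx0 ?_⟩
    rw [← hTT _ _ _ hs h, h0, map_zero]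
  let U : Set ι := {t | (∃ h : t ≤ t₀, T t t₀ h ≠ 0) ∨ ∃ h : t₀ ≤ t, ∃ x ∈ I, T t₀ t h x ≠ 0}
  let v' : ∀ t, V t := fun t =>
    if h : t₀ ≤ t then T t₀ t h v else if hL : ∃ h : t ≤ t₀, T t t₀ h ≠ 0 then w ⟨t, hL⟩ else 0
  let ξ' : ∀ t, V t →ₗ[𝕂] 𝕂 := fun t =>
    if h : t ≤ t₀ then ξ₀ ∘ₗ T t t₀ h
    else if hR : ∃ h : t₀ ≤ t, ∃ x ∈ I, T t₀ t h x ≠ 0 then η ⟨t, hR⟩ else 0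
  have hv'₁ : ∀ t (h : t₀ ≤ t), v' t = T t₀ t h v := fun t h => dif_pos h
  have hv'₂ : ∀ t (h : ∃ h : t ≤ t₀, T t t₀ h ≠ 0), v' t = w ⟨t, h⟩ := by
    intro t h
    by_cases h' : t₀ ≤ t
    · obtain rfl := le_antisymm h.1 h'
      rw [hv'₁ t le_rfl, hTid, ← hw₀]
    · exact (dif_neg h').trans (dif_pos h)
  have hξ'₁ : ∀ t (h : t ≤ t₀), ξ' t = ξ₀ ∘ₗ T t t₀ h := fun t h => dif_pos h
  have hξ'₂ : ∀ t (h : ∃ h : t₀ ≤ t, ∃ x ∈ I, T t₀ t h x ≠ 0), ξ' t = η ⟨t, h⟩ := by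
    intro t h
    by_cases h' : t ≤ t₀
    · obtain rfl := le_antisymm h' h.1
      rw [hξ'₁ t le_rfl, ← hη₀]
      exact LinearMap.ext fun x => congrArg _ (hTid t x)
    · exact (dif_neg h').trans (dif_pos h)
  have hv₀ : v' t₀ = v := (hv'₁ t₀ le_rfl).trans (hTid _ _)
  have hξ₀' : ξ' t₀ = ξ₀ := by
    rw [hξ'₁ t₀ le_rfl]
    exact LinearMap.ext fun x => congrArg _ (hTid t₀ x)
  have hlow : ∀ t (h : ∃ h : t ≤ t₀, T t t₀ h ≠ 0) t' (h₁ : t ≤ t') (_ : t' ≤ t₀),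
      T t t' h₁ (v' t) = v' t' := by
    intro t h t' h₁ h₂
    have h' : ∃ h : t' ≤ t₀, T t' t₀ h ≠ 0 := ⟨h₂, hLup t t' h₁ h₂ h.2⟩
    rw [hv'₂ t h, hv'₂ t' h']
    exact hw ⟨t, h⟩ ⟨t', h'⟩ h₁
  have hupp : ∀ t' (h : ∃ h : t₀ ≤ t', ∃ x ∈ I, T t₀ t' h x ≠ 0) t (h₁ : t ≤ t') (_ : t₀ ≤ t) x,
      ξ' t' (T t t' h₁ x) = ξ' t x := by
    intro t' h t h₁ h₂ x
    have h' : ∃ h : t₀ ≤ t, ∃ x ∈ I, T t₀ t h x ≠ 0 := ⟨h₂, hRdown t t' h₁ h₂ h.2⟩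
    rw [hξ'₂ t h', hξ'₂ t' h]
    exact hη ⟨t, h'⟩ ⟨t', h⟩ h₁ x
  refine ⟨U, v', ξ', Or.inl hLt₀, fun t ht t' h => ?_, fun t' ht' t h x => ?_, fun t ht => ?_,
    fun t ht => ?_, fun t ht => ?_⟩
  · rcases le_total t₀ t with h₀ | h₀
    · rw [hv'₁ t h₀, hv'₁ t' (h₀.trans h), hTT]
    · have htL : ∃ h : t ≤ t₀, T t t₀ h ≠ 0 := by
        rcases ht with ht | ht
        · exact ht
        · obtain rfl := le_antisymm h₀ ht.1
          exact hLt₀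
      rcases le_total t' t₀ with h₁ | h₁
      · exact hlow t htL t' h h₁
      · rw [hv'₁ t' h₁, ← hTT t t₀ t' h₀ h₁, hlow t htL t₀ h₀ le_rfl, hv₀]
  · rcases le_total t' t₀ with h₀ | h₀
    · rw [hξ'₁ t' h₀, hξ'₁ t (h.trans h₀)]
      exact congrArg ξ₀ (hTT _ _ _ _ _ _)
    · have htR : ∃ h : t₀ ≤ t', ∃ x ∈ I, T t₀ t' h x ≠ 0 := by
        rcases ht' with ht | ht
        · obtain rfl := le_antisymm h₀ ht.1
          exact hRt₀
        · exact ht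
      rcases le_total t₀ t with h₁ | h₁
      · exact hupp t' htR t h h₁ x
      · rw [hξ'₁ t h₁, ← hTT t t₀ t' h₁ h₀, hupp t' htR t₀ h₀ le_rfl, hξ₀']
        rfl
  · by_cases h₀ : t₀ ≤ t
    · rw [hv'₁ t h₀]
      by_contra h
      exact ht (Or.inr ⟨h₀, v, hvI, h⟩)
    · exact (dif_neg h₀).trans (dif_neg fun h => ht (Or.inl h))
  · by_cases h₀ : t ≤ t₀
    · rw [hξ'₁ t h₀]
      by_contra h
      refine ht (Or.inl ⟨h₀, fun h' => h ?_⟩)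
      rw [h', LinearMap.comp_zero]
    · exact (dif_neg h₀).trans (dif_neg fun h => ht (Or.inr h))
  · rcases ht with ht | ht
    · rw [hξ'₁ t ht.1, LinearMap.comp_apply, hlow t ht t₀ ht.1 le_rfl, hv₀, hξ₀v]
    · rw [hv'₁ t ht.1, hupp t ht t₀ ht.1 le_rfl, hξ₀', hξ₀v]

end PersistenceModules

/-! ### Strings as retracts -/

/-- The image in the circle of the segment from `s` to `t`. -/
noncomputable def coverHom (s t : ℝ) (h : s ≤ t) : cover s ⟶ cover t :=
  (⟨t - s, sub_nonneg.2 h, by simp [cover]⟩ : Path (cover s) (cover t))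

lemma coverHom_length (s t : ℝ) (h : s ≤ t) : Path.length (coverHom s t h) = t - s := rfl

lemma coverHom_self (t : ℝ) : coverHom t t le_rfl = 𝟙 (cover t) := Path.ext (sub_self t)

lemma coverHom_comp (s t r : ℝ) (h : s ≤ t) (h' : t ≤ r) :
    coverHom s t h ≫ coverHom t r h' = coverHom s r (h.trans h') :=
  Path.ext (by rw [comp_length]; simp only [coverHom_length]; ring)

lemma cover_surjective : Function.Surjective cover := by
  rintro ⟨a⟩
  induction a using Real.Angle.induction_on with
  | _ t => exact ⟨t, rfl⟩

lemma cover_eq_cover_iff {s t : ℝ} : cover s = cover t ↔ ∃ k : ℤ, s - t = 2 * Real.pi * k := by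
  rw [← Real.Angle.angle_eq_iff_two_pi_dvd_sub]
  exact ⟨congrArg Circ.angle, Circ.ext⟩

lemma cover_add_length {x y : Circ} (f : x ⟶ y) {b : ℝ} (hb : cover b = x) :
    cover (b + Path.length f) = y := by
  subst hb
  exact Circ.ext ((Real.Angle.coe_add _ _).trans (Path.target f))

/-- Every path in the circle is the image of a segment of `ℝ`, from any lift `b` of its source. -/
lemma eq_coverHom {x y : Circ} (f : x ⟶ y) {b c : ℝ} (hb : cover b = x) (hc : cover c = y)
    (h : c = b + Path.length f) :
    f = eqToHom hb.symm ≫ coverHom b c (by linarith [Path.nonneg f]) ≫ eqToHom hc := by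
  subst hb hc
  simp only [eqToHom_refl, Category.comp_id, Category.id_comp]
  exact Path.ext (by rw [coverHom_length]; linarith)

lemma finite_fibre {U : Set ℝ} (hU : Bornology.IsBounded U) (x : Circ) :
    Finite {b : ℝ // b ∈ U ∧ cover b = x} := by
  obtain ⟨t, rfl⟩ := cover_surjective x
  obtain ⟨C, hC⟩ := (Metric.isBounded_iff_subset_closedBall t).1 hU
  have hpi := Real.two_pi_pos
  let N : ℤ := ⌈C / (2 * Real.pi)⌉
  refine Set.Finite.subset ((Set.finite_Icc (-N) N).image fun k : ℤ => t + 2 * Real.pi * k) ?_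
  rintro b ⟨hb, hbt⟩
  obtain ⟨k, hk⟩ := cover_eq_cover_iff.1 hbt
  have h1 : |2 * Real.pi * (k : ℝ)| ≤ C := by
    rw [← hk]
    simpa [Real.dist_eq] using hC hb
  have h2 : C ≤ N * (2 * Real.pi) := by
    rw [← div_le_iff₀ hpi]
    exact Int.le_ceil _
  obtain ⟨h3, h4⟩ := abs_le.1 h1
  refine ⟨k, ⟨?_, ?_⟩, by simp only; linarith⟩
  · have : (-(N : ℝ)) ≤ k := by nlinarith
    exact_mod_cast this
  · have : (k : ℝ) ≤ N := by nlinarith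
    exact_mod_cast this

/-- The coefficient of `stringMap 𝕂 U f φ` at `c` is the coefficient of `φ` at `c` minus the length
of `f`, which counts as zero if that point is not in `U`. -/
lemma stringMap_apply {𝕂 : Type u} [Field 𝕂] (U : Set ℝ) {x y : Circ} (f : x ⟶ y)
    (φ : {b : ℝ // b ∈ U ∧ cover b = x} →₀ 𝕂) (c : {b : ℝ // b ∈ U ∧ cover b = y}) :
    (∀ b : {b : ℝ // b ∈ U ∧ cover b = x}, b.1 + Path.length f = c.1 →
      stringMap 𝕂 U f φ c = φ b) ∧
    ((∀ b : {b : ℝ // b ∈ U ∧ cover b = x}, b.1 + Path.length f ≠ c.1) →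
      stringMap 𝕂 U f φ c = 0) := by
  classical
  have key : ∀ (b : {b : ℝ // b ∈ U ∧ cover b = x}) (r : 𝕂),
      stringMap 𝕂 U f (Finsupp.single b r) c = if b.1 + Path.length f = c.1 then r else 0 := by
    intro b r
    rw [← mul_one r, ← smul_eq_mul, ← Finsupp.smul_single, map_smul]
    split_ifs with h
    · rw [stringMap_single_of_mem 𝕂 U f b c h.symm]
      simp
    · by_cases hm : b.1 + Path.length f ∈ U
      · rw [stringMap_single_of_mem 𝕂 U f b ⟨_, hm, cover_add_length f b.2.2⟩ rfl]
        rw [Finsupp.smul_apply, Finsupp.single_apply, if_neg, smul_zero]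
        exact fun h' => h (congrArg Subtype.val h')
      · rw [stringMap_single_of_notMem 𝕂 U f b hm]
        simp
  constructor
  · intro b hb
    induction φ using Finsupp.induction_linear with
    | zero => simp
    | add φ ψ h₁ h₂ => simp [h₁, h₂]
    | single b' r =>
      rw [key, Finsupp.single_apply]
      congr 1
      rw [← hb, add_left_inj, Subtype.ext_iff]
  · intro h
    induction φ using Finsupp.induction_linear with
    | zero => simp
    | add φ ψ h₁ h₂ => simp [h₁, h₂]
    | single b' r => rw [key, if_neg (h b')]

section

variable {𝕂 : Type u} [Field 𝕂] {M : Rep 𝕂}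

/-- A bounded interval summand of the lift of `M` to `ℝ` makes the string over the same interval a
retract of `M`. The composite endomorphism of the string is not the identity, because different
lifts of a point of the circle interact, but it is unitriangular for the order of `ℝ`. -/
theorem exists_isIso_string_comp {U : Set ℝ} (hU : U.OrdConnected)
    (hUb : Bornology.IsBounded U) (v : ∀ t, M.obj (cover t)) (ξ : ∀ t, M.obj (cover t) →ₗ[𝕂] 𝕂)
    (hv : ∀ t ∈ U, ∀ t' (h : t ≤ t'), M.map (coverHom t t' h) (v t) = v t')
    (hξ : ∀ t' ∈ U, ∀ t (h : t ≤ t') x, ξ t' (M.map (coverHom t t' h) x) = ξ t x)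
    (hv₀ : ∀ t ∉ U, v t = 0) (hξ₀ : ∀ t ∉ U, ξ t = 0) (h₁ : ∀ t ∈ U, ξ t (v t) = 1) :
    ∃ (i : string 𝕂 U hU ⟶ M) (r : M ⟶ string 𝕂 U hU), IsIso (i ≫ r) := by
  have hfin := finite_fibre hUb
  -- `v b` and `ξ b` carried to a point `x` of the circle that is only propositionally `cover b`.
  obtain ⟨w, hw⟩ : ∃ w : ∀ (x : Circ) (b : ℝ), cover b = x → M.obj x,
      ∀ b, w (cover b) b rfl = v b := ⟨fun x b h => h ▸ v b, fun b => rfl⟩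
  obtain ⟨η, hη⟩ : ∃ η : ∀ (x : Circ) (b : ℝ), cover b = x → (M.obj x →ₗ[𝕂] 𝕂),
      ∀ b, η (cover b) b rfl = ξ b := ⟨fun x b h => h ▸ ξ b, fun b => rfl⟩
  have hw' : ∀ {x y : Circ} (f : x ⟶ y) (b c : ℝ) (hb : cover b = x) (hc : cover c = y),
      c = b + Path.length f → b ∈ U → M.map f (w x b hb) = w y c hc := by
    intro x y f b c hb hc h hbU
    have hf := eq_coverHom f hb hc h
    subst hb hc
    simp only [eqToHom_refl, Category.comp_id, Category.id_comp] at hf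
    rw [hf, hw, hw, hv b hbU]
  have hη' : ∀ {x y : Circ} (f : x ⟶ y) (b c : ℝ) (hb : cover b = x) (hc : cover c = y),
      c = b + Path.length f → c ∈ U → ∀ z, η y c hc (M.map f z) = η x b hb z := by
    intro x y f b c hb hc h hcU z
    have hf := eq_coverHom f hb hc h
    subst hb hc
    simp only [eqToHom_refl, Category.comp_id, Category.id_comp] at hf
    rw [hf, hη, hη, hξ c hcU]
  have hw₀ : ∀ x b hb, b ∉ U → w x b hb = 0 := by
    rintro x b rfl hbU
    rw [hw, hv₀ b hbU]
  have hη₀ : ∀ x b hb, b ∉ U → η x b hb = 0 := by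
    rintro x b rfl hbU
    rw [hη, hξ₀ b hbU]
  have hηw : ∀ x b hb, b ∈ U → η x b hb (w x b hb) = 1 := by
    rintro x b rfl hbU
    rw [hη, hw, h₁ b hbU]
  -- For `c < b` over the same point, go back by multiples of `b - c` to the last one that stays
  -- in `U` from `b`; the corresponding point below `c` has left `U`, so the pairing vanishes.
  have htri : ∀ x b c hb hc, b ∈ U → c < b → η x c hc (w x b hb) = 0 := by
    intro x b c hb hc hbU hcb
    set δ := b - c with hδ
    have hδ0 : 0 < δ := sub_pos.2 hcb
    obtain ⟨k, hk⟩ := cover_eq_cover_iff.1 (hb.trans hc.symm)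
    by_cases hcU : c ∈ U
    swap
    · rw [hη₀ x c hc hcU]; rfl
    have hex : ∃ n : ℕ, b - (n + 1) * δ ∉ U := by
      obtain ⟨B, hB⟩ := hUb.bddBelow
      obtain ⟨n, hn⟩ := exists_nat_gt ((b - B) / δ)
      refine ⟨n, fun h => ?_⟩
      have h2 := hB h
      rw [div_lt_iff₀ hδ0] at hn
      linarith
    classical
    obtain ⟨n, hn, hmin⟩ : ∃ n : ℕ, b - (n + 1) * δ ∉ U ∧ b - n * δ ∈ U := by
      refine ⟨Nat.find hex, Nat.find_spec hex, ?_⟩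
      rcases hm : Nat.find hex with _ | m
      · simpa using hbU
      · have := Nat.find_min hex (m := m) (by omega)
        push_cast
        exact not_not.1 this
    have hn0 : (0 : ℝ) ≤ n * δ := by positivity
    have hbn : cover (b - n * δ) = x := by
      rw [← hb, cover_eq_cover_iff]
      exact ⟨-(n * k), by push_cast; linear_combination (-n : ℝ) * hk⟩
    have hcn : cover (c - n * δ) = x := by
      rw [← hc, cover_eq_cover_iff]
      exact ⟨-(n * k), by push_cast; linear_combination (-n : ℝ) * hk⟩
    let f : x ⟶ x := (⟨n * δ, hn0, by
      have h1 := congrArg Circ.angle hbn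
      have h2 := congrArg Circ.angle hb
      rw [← h1]
      refine Eq.trans ?_ (h2.trans h1.symm)
      change ((b - n * δ : ℝ) : Real.Angle) + ((n * δ : ℝ) : Real.Angle) = (b : Real.Angle)
      rw [← Real.Angle.coe_add, sub_add_cancel]⟩ : Path x x)
    have hfl : Path.length f = n * δ := rfl
    rw [← hw' f (b - n * δ) b hbn hb (by rw [hfl, sub_add_cancel]) hmin,
      hη' f (c - n * δ) c hcn hc (by rw [hfl, sub_add_cancel]) hcU, hη₀ x _ hcn]
    · rfl
    · rwa [show c - n * δ = b - (n + 1) * δ by rw [hδ]; ring]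
  let i : string 𝕂 U hU ⟶ M :=
    { app := fun x => ModuleCat.ofHom (Finsupp.linearCombination 𝕂
        fun b : {b : ℝ // b ∈ U ∧ cover b = x} => w x b.1 b.2.2)
      naturality := by
        intro x y f
        refine ModuleCat.hom_ext (Finsupp.lhom_ext' fun b => LinearMap.ext_ring ?_)
        change Finsupp.linearCombination 𝕂
            (fun b : {b : ℝ // b ∈ U ∧ cover b = y} => w y b.1 b.2.2)
            (stringMap 𝕂 U f (Finsupp.single b 1)) =
          M.map f (Finsupp.linearCombination 𝕂
            (fun b : {b : ℝ // b ∈ U ∧ cover b = x} => w x b.1 b.2.2) (Finsupp.single b 1))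
        rw [Finsupp.linearCombination_single, one_smul,
          hw' f b.1 _ b.2.2 (cover_add_length f b.2.2) rfl b.2.1]
        by_cases hm : b.1 + Path.length f ∈ U
        · rw [stringMap_single_of_mem 𝕂 U f b ⟨_, hm, cover_add_length f b.2.2⟩ rfl,
            Finsupp.linearCombination_single, one_smul]
        · rw [stringMap_single_of_notMem 𝕂 U f b hm, map_zero, hw₀ _ _ _ hm] }
  let ρ : ∀ x, M.obj x →ₗ[𝕂] ({b : ℝ // b ∈ U ∧ cover b = x} →₀ 𝕂) := fun x =>
    (Finsupp.linearEquivFunOnFinite 𝕂 𝕂 {b : ℝ // b ∈ U ∧ cover b = x}).symm.toLinearMap ∘ₗ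
      LinearMap.pi fun b => η x b.1 b.2.2
  have hρ : ∀ x z b, ρ x z b = η x b.1 b.2.2 z := fun x z b => rfl
  let r : M ⟶ string 𝕂 U hU :=
    { app := fun x => ModuleCat.ofHom (ρ x)
      naturality := by
        intro x y f
        refine ModuleCat.hom_ext (LinearMap.ext fun z => Finsupp.ext fun c => ?_)
        change ρ y (M.map f z) c = stringMap 𝕂 U f (ρ x z) c
        rw [hρ]
        by_cases hex : ∃ b : {b : ℝ // b ∈ U ∧ cover b = x}, b.1 + Path.length f = c.1
        · obtain ⟨b, hb⟩ := hex
          rw [(stringMap_apply U f _ c).1 b hb, hρ, hη' f b.1 c.1 b.2.2 c.2.2 hb.symm c.2.1]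
        · push Not at hex
          rw [(stringMap_apply U f _ c).2 hex]
          have hcx : cover (c.1 - Path.length f) = x := by
            refine Circ.ext ?_
            change ((c.1 - Path.length f : ℝ) : Real.Angle) = x.angle
            rw [Real.Angle.coe_sub, sub_eq_iff_eq_add, Path.target f]
            exact congrArg Circ.angle c.2.2
          rw [hη' f (c.1 - Path.length f) c.1 hcx c.2.2 (by simp) c.2.1,
            hη₀ x _ hcx fun hm => hex ⟨_, hm, hcx⟩ (by simp)]
          rfl }
  refine ⟨i, r, (NatTrans.isIso_iff_isIso_app _).2 fun x => ?_⟩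
  let E : ({b : ℝ // b ∈ U ∧ cover b = x} →₀ 𝕂) →ₗ[𝕂] ({b : ℝ // b ∈ U ∧ cover b = x} →₀ 𝕂) :=
    ρ x ∘ₗ Finsupp.linearCombination 𝕂 fun b => w x b.1 b.2.2
  have hE : Function.Injective E := by
    rw [← LinearMap.ker_eq_bot, LinearMap.ker_eq_bot']
    intro φ hφ
    by_contra hφ0
    obtain ⟨b, hb, hmin⟩ := φ.support.exists_minimal (Finsupp.support_nonempty_iff.2 hφ0)
    refine Finsupp.mem_support_iff.1 hb ?_
    have h0 : E φ b = 0 := by rw [hφ]; rfl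
    change η x b.1 b.2.2 (Finsupp.linearCombination 𝕂 (fun b => w x b.1 b.2.2) φ) = 0 at h0
    rw [Finsupp.linearCombination_apply, Finsupp.sum, map_sum, Finset.sum_eq_single b] at h0
    · simpa [hηw x b.1 b.2.2 b.2.1] using h0
    · intro c hc hcb
      rw [map_smul]
      have hlt : b.1 < c.1 := by
        refine lt_of_not_ge fun hle => hcb ?_
        exact le_antisymm hle (hmin hc hle)
      rw [htri x c.1 b.1 c.2.2 b.2.2 c.2.1 hlt, smul_zero]
    · exact fun h => (h hb).elim
  have hEb : Function.Bijective E := ⟨hE, LinearMap.injective_iff_surjective.1 hE⟩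
  change IsIso (ModuleCat.ofHom E)
  exact (LinearEquiv.ofBijective E hEb).toModuleIso.isIso_hom

end

/-! ### Idempotents and indecomposable summands -/

section Summands

variable {𝕂 : Type u} [Field 𝕂]

lemma isDirectSummand_of_retraction {S N : Rep 𝕂} (i : S ⟶ N) (r : N ⟶ S) (h : i ≫ r = 𝟙 S) :
    IsDirectSummand S N := by
  have : Mono i := mono_of_mono_fac h
  let C : ShortComplex (Rep 𝕂) := ShortComplex.mk i (cokernel.π i) (cokernel.condition i)
  have hC : C.Exact := ShortComplex.exact_cokernel i
  have : Epi C.g := inferInstanceAs (Epi (cokernel.π i))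
  let s : C.Splitting := ShortComplex.Splitting.ofExactOfRetraction C hC r h inferInstance
  exact ⟨cokernel i, ⟨s.isoBinaryBiproduct⟩⟩

lemma IsPointwiseFinite.of_mono {M N : Rep 𝕂} (hM : IsPointwiseFinite M)
    (i : N ⟶ M) [Mono i] : IsPointwiseFinite N := by
  intro x
  have := hM x
  have hx : Mono (i.app x) := inferInstance
  exact Module.Finite.of_injective (i.app x).hom ((ModuleCat.mono_iff_injective _).1 hx)

/-- Among the idempotent endomorphisms of `M` that do not vanish on the image of `M.map f` there is
a minimal one, by Zorn's lemma: a chain of idempotents is stationary at each point of the circle,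
because ranks are finite there, and its pointwise limit is again an idempotent. -/
theorem exists_minimal_idempotent {M : Rep 𝕂} (hM : IsPointwiseFinite M) {x y : Circ}
    (f : x ⟶ y) (hf : M.map f ≠ 0) :
    ∃ e : M ⟶ M, e ≫ e = e ∧ M.map f ≫ e.app y ≠ 0 ∧
      ∀ e' : M ⟶ M, e' ≫ e' = e' → M.map f ≫ e'.app y ≠ 0 → e' ≫ e = e' → e ≫ e' = e' →
        e' = e := by
  classical
  let α : Type _ := {e : M ⟶ M // e ≫ e = e ∧ M.map f ≫ e.app y ≠ 0}
  let R : α → α → Prop := fun e e' => e'.1 ≫ e.1 = e'.1 ∧ e.1 ≫ e'.1 = e'.1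
  have hrefl : ∀ e, R e e := fun e => ⟨e.2.1, e.2.1⟩
  have htrans : ∀ {a b c : α}, R a b → R b c → R a c := by
    rintro a b c ⟨h₁, h₂⟩ ⟨h₃, h₄⟩
    constructor
    · rw [← h₃, Category.assoc, h₁]
    · rw [← h₄, ← Category.assoc, h₂]
  have : Nonempty α := ⟨⟨𝟙 M, by simp, by simpa using hf⟩⟩
  let d : α → Circ → ℕ := fun e z => Module.finrank 𝕂 (LinearMap.range (e.1.app z).hom)
  have hd : ∀ (e e' : α) z, R e e' → d e z ≤ d e' z → e'.1.app z = e.1.app z := by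
    rintro e e' z ⟨h₁, h₂⟩ hle
    have := hM z
    have h₁' : ∀ w, e.1.app z (e'.1.app z w) = e'.1.app z w := fun w =>
      ConcreteCategory.congr_hom (NatTrans.congr_app h₁ z) w
    have h₂' : ∀ w, e'.1.app z (e.1.app z w) = e'.1.app z w := fun w =>
      ConcreteCategory.congr_hom (NatTrans.congr_app h₂ z) w
    have h₃ : ∀ w, e'.1.app z (e'.1.app z w) = e'.1.app z w := fun w =>
      ConcreteCategory.congr_hom (NatTrans.congr_app e'.2.1 z) w
    have hsub : LinearMap.range (e'.1.app z).hom ≤ LinearMap.range (e.1.app z).hom := by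
      rintro _ ⟨w, rfl⟩
      exact ⟨_, h₁' w⟩
    have heq := Submodule.eq_of_le_of_finrank_le hsub hle
    refine ModuleCat.hom_ext (LinearMap.ext fun w => ?_)
    obtain ⟨w', hw'⟩ : (e.1.app z).hom w ∈ LinearMap.range (e'.1.app z).hom := by
      rw [heq]; exact ⟨w, rfl⟩
    have h₄ := h₂' w
    have h₅ : e'.1.app z w' = e.1.app z w := hw'
    rw [← h₅, h₃, h₅] at h₄
    exact h₄.symm
  obtain ⟨m, hm⟩ := exists_maximal_of_nonempty_chains_bounded (r := R) (by
    intro c hc hne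
    have : Nonempty c := hne.to_subtype
    -- The member `s z` of the chain has least rank at `z`, so the chain is stationary there
    -- from `s z` on.
    let s : Circ → c := fun z => Function.argmin (fun e : c => d e.1 z)
    have hs : ∀ z (e : c), R (s z).1 e.1 → e.1.1.app z = (s z).1.1.app z := fun z e he =>
      hd _ _ z he (Function.argmin_le (fun e : c => d e.1 z) e)
    have hdir : ∀ a b : c, ∃ e : c, R a.1 e.1 ∧ R b.1 e.1 := by
      intro a b
      by_cases hab : a.1 = b.1
      · exact ⟨a, hrefl _, hab ▸ hrefl _⟩
      rcases hc a.2 b.2 hab with h | h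
      · exact ⟨b, h, hrefl _⟩
      · exact ⟨a, hrefl _, h⟩
    let E : M ⟶ M :=
      { app := fun z => (s z).1.1.app z
        naturality := by
          intro z z' k
          obtain ⟨e, he, he'⟩ := hdir (s z) (s z')
          rw [← hs z e he, ← hs z' e he', e.1.1.naturality] }
    have hE : ∀ z (e : c), R (s z).1 e.1 → E.app z = e.1.1.app z := fun z e he => (hs z e he).symm
    refine ⟨⟨E, ?_, ?_⟩, ?_⟩
    · ext1; ext1 z
      exact NatTrans.congr_app (s z).1.2.1 z
    · exact (s y).1.2.2
    · intro e he
      constructor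
      · ext1; ext1 z
        obtain ⟨e', h₁, h₂⟩ := hdir (s z) ⟨e, he⟩
        rw [NatTrans.comp_app, hE z e' h₁]
        exact NatTrans.congr_app h₂.1 z
      · ext1; ext1 z
        obtain ⟨e', h₁, h₂⟩ := hdir (s z) ⟨e, he⟩
        rw [NatTrans.comp_app, hE z e' h₁]
        exact NatTrans.congr_app h₂.2 z) htrans
  refine ⟨m.1, m.2.1, m.2.2, fun e' he' hfe' h₁ h₂ => ?_⟩
  have := hm ⟨e', he', hfe'⟩ ⟨h₁, h₂⟩
  exact h₂.symm.trans this.1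

/-- A path acting non-trivially on `M` acts non-trivially on some indecomposable summand of `M`. -/
theorem exists_indecomposable_summand {M : Rep 𝕂} (hM : IsPointwiseFinite M) {x y : Circ}
    (f : x ⟶ y) (hf : M.map f ≠ 0) :
    ∃ N : Rep 𝕂, IsDirectSummand N M ∧ Indecomposable N ∧ N.map f ≠ 0 := by
  obtain ⟨e, he, hfe, hmin⟩ := exists_minimal_idempotent hM f hf
  obtain ⟨N, i, p, hip, hpi⟩ := IsIdempotentComplete.idempotents_split M e he
  have hNf : N.map f ≠ 0 := by
    intro h
    refine hfe ?_
    rw [← hpi, NatTrans.comp_app, ← Category.assoc, p.naturality, h, comp_zero, zero_comp]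
  refine ⟨N, isDirectSummand_of_retraction i p hip,
    ⟨fun h => hNf ((Functor.isZero_iff N).1 h x |>.eq_of_src _ _), fun A B φ => ?_⟩, hNf⟩
  -- By minimality, an idempotent of `N` that is still non-zero on `f` is the identity.
  have key : ∀ q : N ⟶ N, q ≫ q = q →
      M.map f ≫ (p ≫ q ≫ i).app y ≠ 0 → q = 𝟙 N := by
    intro q hq hne
    have h := hmin (p ≫ q ≫ i) (by simp only [Category.assoc, reassoc_of% hip, reassoc_of% hq]) hne
      (by rw [← hpi]; simp only [Category.assoc, reassoc_of% hip])
      (by rw [← hpi]; simp only [Category.assoc, reassoc_of% hip])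
    have h2 : i ≫ (p ≫ q ≫ i) ≫ p = i ≫ e ≫ p := by rw [h]
    simpa only [← hpi, Category.assoc, hip, reassoc_of% hip, Category.comp_id] using h2
  let qA : N ⟶ N := φ.hom ≫ biprod.fst ≫ biprod.inl ≫ φ.inv
  let qB : N ⟶ N := φ.hom ≫ biprod.snd ≫ biprod.inr ≫ φ.inv
  have hsum : qA + qB = 𝟙 N := by
    have : qA + qB = φ.hom ≫ (biprod.fst ≫ biprod.inl + biprod.snd ≫ biprod.inr) ≫ φ.inv := by
      simp only [qA, qB, Preadditive.add_comp, Preadditive.comp_add, Category.assoc]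
    rw [this, biprod.total, Category.id_comp, Iso.hom_inv_id]
  have hqA : qA ≫ qA = qA := by simp [qA]
  have hqB : qB ≫ qB = qB := by simp [qB]
  have hor : M.map f ≫ (p ≫ qA ≫ i).app y ≠ 0 ∨ M.map f ≫ (p ≫ qB ≫ i).app y ≠ 0 := by
    by_contra! h
    refine hfe ?_
    have : e = p ≫ qA ≫ i + p ≫ qB ≫ i := by
      rw [← Preadditive.comp_add, ← Preadditive.add_comp, hsum, Category.id_comp, hpi]
    rw [this, NatTrans.app_add, Preadditive.comp_add, h.1, h.2, add_zero]
  rcases hor with h | h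
  · right
    have h1 := key qA hqA h
    have h2 : qB = 0 := by rw [h1] at hsum; exact left_eq_add.1 hsum.symm
    rw [IsZero.iff_id_eq_zero]
    have : 𝟙 B = biprod.inr ≫ φ.inv ≫ qB ≫ φ.hom ≫ biprod.snd := by simp [qB]
    rw [this, h2]; simp
  · left
    have h1 := key qB hqB h
    have h2 : qA = 0 := by rw [h1] at hsum; exact right_eq_add.1 hsum.symm
    rw [IsZero.iff_id_eq_zero]
    have : 𝟙 A = biprod.inl ≫ φ.inv ≫ qA ≫ φ.hom ≫ biprod.fst := by simp [qA]
    rw [this, h2]; simp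

end Summands

/-! ### Nakayama representations via vanishing of long paths -/

section Nakayama

variable (𝕂 : Type u) [Field 𝕂] (κ : KupischFunction)

/-- The pointwise finite representations on which a path starting at `t` and of length more than
`κ t` acts as zero. Unlike `IsNakayama`, this condition does not refer to decompositions. -/
def VanishesBeyond : ObjectProperty (Rep 𝕂) := fun M => IsPointwiseFinite M ∧
  ∀ (t : ℝ) (y : Circ) (f : cover t ⟶ y), κ.toFun t < Path.length f → M.map f = 0

variable {κ}

lemma KupischFunction.apply_eq_of_cover_eq {s t : ℝ} (h : cover s = cover t) :
    κ.toFun s = κ.toFun t := by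
  obtain ⟨k, hk⟩ := cover_eq_cover_iff.1 h
  have hp : Function.Periodic κ.toFun (2 * Real.pi) := κ.periodic
  rw [← hp.int_mul k t]
  congr 1
  linarith

variable {𝕂}

theorem IsNakayama.vanishesBeyond {M : Rep 𝕂} (hM : IsNakayama 𝕂 κ M) :
    VanishesBeyond 𝕂 κ M := by
  refine ⟨hM.1, fun t y f hf => ?_⟩
  by_contra h
  obtain ⟨N, hNM, hN, hNf⟩ := exists_indecomposable_summand hM.1 f h
  obtain ⟨U, hU, -, -, hUκ, ⟨φ⟩⟩ := hM.2 N hNM hN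
  refine hNf ?_
  have hS : (string 𝕂 U hU).map f = 0 := by
    refine ModuleCat.hom_ext (Finsupp.lhom_ext' fun b => LinearMap.ext_ring ?_)
    refine stringMap_single_of_notMem 𝕂 U f b fun hb => ?_
    have h₁ := hUκ b.2.1
    have h₂ := (hUκ hb).2
    have h₃ := κ.add_le_add _ _ h₁.1
    rw [KupischFunction.apply_eq_of_cover_eq b.2.2] at h₃
    linarith
  have h₁ : N.map f = φ.hom.app _ ≫ (string 𝕂 U hU).map f ≫ φ.inv.app _ := by
    rw [φ.inv.naturality, ← Category.assoc, ← NatTrans.comp_app, φ.hom_inv_id]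
    simp
  rw [h₁, hS, zero_comp, comp_zero]

lemma VanishesBeyond.of_mono {M N : Rep 𝕂} (hM : VanishesBeyond 𝕂 κ M) (i : N ⟶ M) [Mono i] :
    VanishesBeyond 𝕂 κ N := by
  refine ⟨hM.1.of_mono i, fun t y f hf => ?_⟩
  rw [← cancel_mono (i.app y), i.naturality, hM.2 t y f hf, comp_zero, zero_comp]

lemma VanishesBeyond.of_epi {M N : Rep 𝕂} (hM : VanishesBeyond 𝕂 κ M) (p : M ⟶ N) [Epi p] :
    VanishesBeyond 𝕂 κ N := by
  refine ⟨fun x => ?_, fun t y f hf => ?_⟩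
  · have := hM.1 x
    have hx : Epi (p.app x) := inferInstance
    exact Module.Finite.of_surjective (p.app x).hom ((ModuleCat.epi_iff_surjective _).1 hx)
  · rw [← cancel_epi (p.app _), ← p.naturality, hM.2 t y f hf, comp_zero, zero_comp]

/-- The indecomposable representations satisfying the vanishing condition are strings: the lift to
`ℝ` has an interval summand, the vanishing condition bounds its support, and the string over it
is a non-zero summand. -/
lemma exists_string_iso {N : Rep 𝕂} (hN : VanishesBeyond 𝕂 κ N) (hind : Indecomposable N) :
    ∃ (U : Set ℝ) (hU : U.OrdConnected), U.Nonempty ∧ Bornology.IsBounded U ∧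
      (∀ t ∈ U, ∀ t' ∈ U, t' ≤ t + κ.toFun t) ∧ Nonempty (N ≅ string 𝕂 U hU) := by
  obtain ⟨t₀, ht₀⟩ : ∃ t₀ : ℝ, Nontrivial (N.obj (cover t₀)) := by
    by_contra! h
    refine hind.1 ((Functor.isZero_iff N).2 fun x => ?_)
    obtain ⟨t, rfl⟩ := cover_surjective x
    have := h t
    exact ModuleCat.isZero_of_subsingleton _
  have hfd' : ∀ t : ℝ, FiniteDimensional 𝕂 (N.obj (cover t)) := fun t => hN.1 _
  let T : ∀ s t : ℝ, s ≤ t → N.obj (cover s) →ₗ[𝕂] N.obj (cover t) :=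
    fun s t h => (N.map (coverHom s t h)).hom
  have hdir : DirectedSystem (fun t : ℝ => N.obj (cover t)) fun s t h => T s t h :=
    ⟨fun t z => by
        change N.map (coverHom t t le_rfl) z = z
        rw [coverHom_self, N.map_id]; rfl,
      fun s t r h h' z => by
        change N.map (coverHom t s h') (N.map (coverHom r t h) z) = N.map (coverHom r s _) z
        rw [← coverHom_comp _ _ _ h h', N.map_comp]; rfl⟩
  obtain ⟨U, v, ξ, htU, hv, hξ, hv₀, hξ₀, h₁⟩ := exists_interval_summand T t₀
  have hU : U.OrdConnected := by
    refine ⟨fun s hs t ht r hr => ?_⟩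
    by_contra hrU
    have h2 := h₁ t ht
    have h3 : T r t hr.2 (T s r hr.1 (v s)) = T s t (hr.1.trans hr.2) (v s) :=
      DirectedSystem.map_map (f := fun i j h => T i j h) hr.1 hr.2 (v s)
    rw [← hv s hs t (hr.1.trans hr.2), ← h3, hv s hs, hv₀ r hrU, map_zero, map_zero] at h2
    exact zero_ne_one h2
  have hκ : ∀ t ∈ U, ∀ t' ∈ U, t' ≤ t + κ.toFun t := by
    intro t ht t' ht'
    by_contra! hlt
    have hle : t ≤ t' := by linarith [κ.pos t]
    have h2 := h₁ t' ht'
    have h3 : N.map (coverHom t t' hle) = 0 :=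
      hN.2 t _ _ (by rw [coverHom_length]; linarith)
    have h4 : T t t' hle = 0 := congrArg ModuleCat.Hom.hom h3
    rw [← hv t ht t' hle, h4, LinearMap.zero_apply, map_zero] at h2
    exact zero_ne_one h2
  have hbdd : Bornology.IsBounded U := by
    obtain ⟨k, hk⟩ := exists_nat_gt (κ.toFun t₀ / (2 * Real.pi))
    rw [div_lt_iff₀ Real.two_pi_pos] at hk
    refine (Metric.isBounded_Icc (t₀ - k * (2 * Real.pi)) (t₀ + κ.toFun t₀)).subset
      fun t ht => ⟨?_, hκ t₀ htU t ht⟩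
    by_contra! hlt
    have h2 := κ.add_le_add _ _ hlt.le
    have h3 : κ.toFun (t₀ - k * (2 * Real.pi)) = κ.toFun t₀ :=
      Function.Periodic.sub_nat_mul_eq κ.periodic k
    have h4 := hκ t ht t₀ htU
    linarith
  refine ⟨U, hU, ⟨t₀, htU⟩, hbdd, hκ, ?_⟩
  obtain ⟨i, r, hir⟩ := exists_isIso_string_comp hU hbdd v ξ hv hξ hv₀ hξ₀ h₁
  obtain ⟨N', ⟨φ⟩⟩ := isDirectSummand_of_retraction i (r ≫ inv (i ≫ r)) (by
    rw [← Category.assoc, IsIso.hom_inv_id])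
  rcases hind.2 _ _ φ with hz | hz
  · have hz' := (Functor.isZero_iff _).1 hz (cover t₀)
    have hs := ModuleCat.subsingleton_of_isZero hz'
    have h2 : (Finsupp.single ⟨t₀, htU, rfl⟩ 1 :
      {b : ℝ // b ∈ U ∧ cover b = cover t₀} →₀ 𝕂) = 0 := hs.elim _ _
    exact (one_ne_zero (Finsupp.single_eq_zero.1 h2)).elim
  · exact ⟨φ ≪≫ (isoBiprodZero hz).symm⟩

/-- Right continuity is needed when the interval does not contain its infimum: the bound
`t' ≤ t + κ t` for the points `t` of the interval then has to pass to the limit. -/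
theorem VanishesBeyond.isNakayama
    (hκ : ∀ a, ContinuousWithinAt κ.toFun (Set.Ioi a) a) {M : Rep 𝕂}
    (hM : VanishesBeyond 𝕂 κ M) : IsNakayama 𝕂 κ M := by
  refine ⟨hM.1, fun N hN hind => ?_⟩
  obtain ⟨N', ⟨φ⟩⟩ := hN
  obtain ⟨U, hU, hne, hb, hUκ, hiso⟩ :=
    exists_string_iso (hM.of_mono (biprod.inl ≫ φ.inv)) hind
  refine ⟨U, hU, hne, hb, fun t' ht' => ⟨csInf_le hb.bddBelow ht', ?_⟩, hiso⟩
  by_cases ha : sInf U ∈ U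
  · exact hUκ _ ha _ ht'
  have hlt : sInf U < t' := lt_of_le_of_ne (csInf_le hb.bddBelow ht') fun h => ha (h ▸ ht')
  have hcont : Filter.Tendsto (fun t => t + κ.toFun t) (nhdsWithin (sInf U) (Set.Ioi (sInf U)))
      (nhds (sInf U + κ.toFun (sInf U))) :=
    (continuousWithinAt_id.add (hκ (sInf U)))
  refine ge_of_tendsto hcont ?_
  filter_upwards [Ioo_mem_nhdsGT hlt] with t ht
  obtain ⟨s, hs, hst⟩ := exists_lt_of_csInf_lt hne ht.1
  exact hUκ t (hU.out hs ht' ⟨hst.le, ht.2.le⟩) t' ht'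

theorem isNakayama_eq_vanishesBeyond (hκ : ∀ a, ContinuousWithinAt κ.toFun (Set.Ioi a) a) :
    IsNakayama 𝕂 κ = VanishesBeyond 𝕂 κ := by
  ext M
  exact ⟨fun h => h.vanishesBeyond, fun h => h.isNakayama hκ⟩

end Nakayama

/-! ### Right continuity of the Kupisch function of an `∞`-gon -/

namespace InfinityGon

variable {m : ℕ} (Z : InfinityGon m)

/-- A point of `[0, 2π)` that is in no interval `[z, z⁺)` is an accumulation point. -/
lemma exists_acc_eq {s : ℝ} (h0 : 0 ≤ s) (h1 : s < 2 * Real.pi)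
    (h : ¬ ∃ q : Fin m × ℤ, s ∈ Set.Ico (Z.pt q.1 q.2) (Z.pt q.1 (q.2 + 1))) :
    ∃ p : Fin m, s = Z.acc p.castSucc := by
  obtain ⟨p, hp, hmax⟩ : ∃ p : Fin (m + 1), Z.acc p ≤ s ∧ ∀ q, Z.acc q ≤ s → q ≤ p := by
    obtain ⟨p, hp⟩ := (Set.toFinite {q : Fin (m + 1) | Z.acc q ≤ s}).exists_maximal
      ⟨0, by simpa [Z.acc_zero] using h0⟩
    exact ⟨p, hp.1, fun q hq => le_of_not_gt fun hlt => hlt.not_ge (hp.2 hq hlt.le)⟩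
  induction p using Fin.lastCases with
  | last => exact absurd (hp.trans_lt h1) (by rw [Z.acc_last]; exact lt_irrefl _)
  | cast p =>
    refine ⟨p, hp.antisymm' (le_of_not_gt fun hlt => h ?_)⟩
    have hs : s < Z.acc p.succ := by
      by_contra! hle
      have := hmax _ hle
      rw [Fin.le_def] at this
      simp at this
    obtain ⟨n₀, hn₀⟩ := ((Z.tendsto_atBot p).eventually_lt_const hlt).exists
    obtain ⟨n₁, hn₁⟩ := ((Z.tendsto_atTop p).eventually_const_lt hs).exists
    obtain ⟨n, hn, hnmax⟩ := Int.exists_greatest_of_bdd (P := fun n => Z.pt p n ≤ s)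
      ⟨n₁, fun n hn => ((Z.pt_strictMono p).lt_iff_lt.1 (hn.trans_lt hn₁)).le⟩ ⟨n₀, hn₀.le⟩
    refine ⟨(p, n), hn, lt_of_not_ge fun hle => ?_⟩
    have := hnmax _ hle
    omega

lemma tendsto_next {s : ℝ} (h0 : 0 ≤ s) (h1 : s < 2 * Real.pi) :
    Filter.Tendsto Z.next (nhdsWithin s (Set.Ioi s)) (nhds (Z.next s)) := by
  by_cases h : ∃ q : Fin m × ℤ, s ∈ Set.Ico (Z.pt q.1 q.2) (Z.pt q.1 (q.2 + 1))
  · obtain ⟨q, hq⟩ := h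
    rw [Z.next_eq hq]
    refine tendsto_const_nhds.congr' ?_
    filter_upwards [Ioo_mem_nhdsGT hq.2] with t ht
    exact (Z.next_eq ⟨hq.1.trans ht.1.le, ht.2⟩).symm
  · rw [Z.next_eq_self h]
    obtain ⟨p, rfl⟩ := Z.exists_acc_eq h0 h1 h
    rw [tendsto_order]
    constructor
    · intro a ha
      filter_upwards [self_mem_nhdsWithin] with t ht
      exact ha.trans (lt_of_lt_of_le ht (Z.le_next t))
    · intro a ha
      obtain ⟨n, hn⟩ := ((Z.tendsto_atBot p).eventually_lt_const ha).exists
      filter_upwards [Ioo_mem_nhdsGT (Z.acc_lt_pt p (n - 1))] with t ht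
      refine (Z.next_mono ht.2.le).trans_lt ?_
      rw [Z.next_eq (p := p) (n := n - 1) ⟨le_rfl, Z.pt_strictMono p (by omega)⟩]
      simpa using hn

/-- The Kupisch function is right continuous; at an accumulation point this holds because the
vertices `z` above it, and hence also the `z⁺`, converge to it. -/
lemma continuousWithinAt_kupisch (a : ℝ) :
    ContinuousWithinAt Z.kupisch.toFun (Set.Ioi a) a := by
  have hpi := Real.two_pi_pos
  set s := toIcoMod Real.two_pi_pos 0 a with hs
  set k := toIcoDiv Real.two_pi_pos 0 a
  have e : s + k • (2 * Real.pi) = a := toIcoMod_add_toIcoDiv_zsmul Real.two_pi_pos 0 a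
  have hs0 : 0 ≤ s := left_le_toIcoMod Real.two_pi_pos 0 a
  have hs1 : s < 2 * Real.pi := by simpa using toIcoMod_lt_right Real.two_pi_pos 0 a
  have hmap : Filter.Tendsto (fun t : ℝ => s + (t - a)) (nhdsWithin a (Set.Ioi a))
      (nhdsWithin s (Set.Ioi s)) := by
    refine tendsto_nhdsWithin_iff.2 ⟨?_, ?_⟩
    · have : Filter.Tendsto (fun t : ℝ => s + (t - a)) (nhds a) (nhds (s + (a - a))) :=
        (continuous_const.add (continuous_id.sub continuous_const)).tendsto a
      rw [sub_self, add_zero] at this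
      exact this.mono_left nhdsWithin_le_nhds
    · filter_upwards [self_mem_nhdsWithin] with t ht
      rw [Set.mem_Ioi] at ht ⊢
      linarith
  have hlim := (((Z.tendsto_next hs0 hs1).comp hmap).const_add (2 * Real.pi)).sub
    (hmap.mono_right nhdsWithin_le_nhds)
  have hlt : a < a + (2 * Real.pi - s) := by linarith
  refine Filter.Tendsto.congr' ?_ hlim
  filter_upwards [Ioo_mem_nhdsGT hlt] with t ht
  have ht' : toIcoMod Real.two_pi_pos 0 t = s + (t - a) := by
    have h2 := (toIcoMod_eq_self Real.two_pi_pos (a := 0) (b := s + (t - a))).2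
      ⟨by linarith [ht.1], by linarith [ht.2]⟩
    have h3 : s + (t - a) + k • (2 * Real.pi) = t := by linarith
    have h4 := toIcoMod_add_zsmul Real.two_pi_pos 0 (s + (t - a)) k
    rwa [h3, h2] at h4
  change 2 * Real.pi + Z.next (s + (t - a)) - (s + (t - a)) =
    2 * Real.pi + Z.next (toIcoMod Real.two_pi_pos 0 t) - toIcoMod Real.two_pi_pos 0 t
  rw [ht']

end InfinityGon

/-! ### Arcs of the circle -/

lemma arc_eq_of_coe {x y : Circ} {r : ℝ} (h0 : 0 ≤ r) (h1 : r < 2 * Real.pi)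
    (h : (r : Real.Angle) = y.angle - x.angle) : arc x y = r := by
  have hpi := Real.two_pi_pos
  rw [← coe_arc] at h
  obtain ⟨k, hk⟩ := Real.Angle.angle_eq_iff_two_pi_dvd_sub.1 h
  have ha := arc_nonneg x y
  have hb := arc_lt x y
  have h2 : k < 1 := by
    have : (k : ℝ) < 1 := by nlinarith
    exact_mod_cast this
  have h3 : -1 < k := by
    have : (-1 : ℝ) < k := by nlinarith
    exact_mod_cast this
  obtain rfl : k = 0 := by omega
  simp at hk
  linarith

lemma arc_add_arc {x y z : Circ} (h : arc x y ≤ arc x z) : arc x y + arc y z = arc x z := by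
  have h1 : arc y z = arc x z - arc x y := by
    refine arc_eq_of_coe (by linarith) (by linarith [arc_lt x z, arc_nonneg x y]) ?_
    rw [Real.Angle.coe_sub, coe_arc, coe_arc]
    abel
  linarith

/-- If the arc from `a'` to `b'` is nested in the arc from `a` to `b` around `p`, then pairs of
points in the former are pairs of points in the latter. -/
lemma CyclicLTLELE.of_nested {a a' p b b' x y : Circ} (h : CyclicLTLT a p b)
    (h' : CyclicLTLT a' p b') (h₁ : arc a' p ≤ arc a p) (h₂ : arc p b' ≤ arc p b)
    (hxy : CyclicLTLELE a' x y b') : CyclicLTLELE a x y b := by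
  have e := arc_add_arc h.2.le
  have e' := arc_add_arc h'.2.le
  have hlt := arc_lt a b
  have key : ∀ z, arc a' z ≤ arc a' b' → arc a z = (arc a p - arc a' p) + arc a' z := by
    intro z hz
    refine arc_eq_of_coe (by linarith [arc_nonneg a' z]) (by linarith) ?_
    rw [Real.Angle.coe_add, Real.Angle.coe_sub, coe_arc, coe_arc, coe_arc]
    abel
  obtain ⟨hx, hxy, hyb⟩ := hxy
  have kx := key x (hxy.trans hyb)
  have ky := key y hyb
  exact ⟨by linarith, by linarith, by linarith⟩

lemma CyclicLTLT.of_nested {a a' p b b' : Circ} (h : CyclicLTLT a p b) (h₁ : arc a' p ≤ arc a p)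
    (h₀ : 0 < arc a' p) (h₂ : arc p b' ≤ arc p b) (h₀' : 0 < arc p b') : CyclicLTLT a' p b' := by
  have e := arc_add_arc h.2.le
  have hlt := arc_lt a b
  have : arc a' b' = arc a' p + arc p b' := by
    refine arc_eq_of_coe (by linarith) (by linarith) ?_
    rw [Real.Angle.coe_add, coe_arc, coe_arc]
    abel
  exact ⟨h₀, by linarith⟩

lemma CyclicLTLT.arc_pos {a p b : Circ} (h : CyclicLTLT a p b) : 0 < arc p b := by
  have e := arc_add_arc h.2.le
  linarith [h.2]

/-- Two arcs around `p` contain a common arc around `p`, whose ends are ends of the given ones. -/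
lemma CyclicLTLT.exists_nested {a₁ b₁ a₂ b₂ p : Circ} (h₁ : CyclicLTLT a₁ p b₁)
    (h₂ : CyclicLTLT a₂ p b₂) :
    ∃ a ∈ ({a₁, a₂} : Set Circ), ∃ b ∈ ({b₁, b₂} : Set Circ), CyclicLTLT a p b ∧
      ∀ x y, CyclicLTLELE a x y b → CyclicLTLELE a₁ x y b₁ ∧ CyclicLTLELE a₂ x y b₂ := by
  obtain ⟨a, ha, ha₁, ha₂, ha0⟩ : ∃ a ∈ ({a₁, a₂} : Set Circ), arc a p ≤ arc a₁ p ∧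
      arc a p ≤ arc a₂ p ∧ 0 < arc a p := by
    rcases le_total (arc a₁ p) (arc a₂ p) with h | h
    · exact ⟨a₁, Or.inl rfl, le_rfl, h, h₁.1⟩
    · exact ⟨a₂, Or.inr rfl, h, le_rfl, h₂.1⟩
  obtain ⟨b, hb, hb₁, hb₂, hb0⟩ : ∃ b ∈ ({b₁, b₂} : Set Circ), arc p b ≤ arc p b₁ ∧
      arc p b ≤ arc p b₂ ∧ 0 < arc p b := by
    rcases le_total (arc p b₁) (arc p b₂) with h | h
    · exact ⟨b₁, Or.inl rfl, le_rfl, h, h₁.arc_pos⟩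
    · exact ⟨b₂, Or.inr rfl, h, le_rfl, h₂.arc_pos⟩
  have hab := h₁.of_nested ha₁ ha0 hb₁ hb0
  exact ⟨a, ha, b, hb, hab, fun x y hxy =>
    ⟨hxy.of_nested h₁ hab ha₁ hb₁, hxy.of_nested h₂ hab ha₂ hb₂⟩⟩

/-! ### Objects at which a transformation of exact functors is invertible -/

section NatTransIso

variable {A B : Type*} [Category A] [Category B] {F G : A ⥤ B} (τ : F ⟶ G)

lemma isIso_app_of_isLimit {J : Type*} [Category J] {K : J ⥤ A} {c : Cone K} (hc : IsLimit c)
    [PreservesLimit K F] [PreservesLimit K G] (h : ∀ j, IsIso (τ.app (K.obj j))) :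
    IsIso (τ.app c.pt) := by
  let α : K ⋙ F ≅ K ⋙ G := NatIso.ofComponents (fun j => asIso (τ.app (K.obj j)))
    (fun f => τ.naturality _)
  have : τ.app c.pt = (IsLimit.conePointsIsoOfNatIso (isLimitOfPreserves F hc)
      (isLimitOfPreserves G hc) α).hom := by
    refine (isLimitOfPreserves G hc).hom_ext fun j => ?_
    rw [IsLimit.conePointsIsoOfNatIso_hom_comp]
    exact (τ.naturality _).symm
  rw [this]
  infer_instance

lemma isIso_app_of_isColimit {J : Type*} [Category J] {K : J ⥤ A} {c : Cocone K}
    (hc : IsColimit c) [PreservesColimit K F] [PreservesColimit K G]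
    (h : ∀ j, IsIso (τ.app (K.obj j))) : IsIso (τ.app c.pt) := by
  let α : K ⋙ F ≅ K ⋙ G := NatIso.ofComponents (fun j => asIso (τ.app (K.obj j)))
    (fun f => τ.naturality _)
  have : τ.app c.pt = (IsColimit.coconePointsIsoOfNatIso (isColimitOfPreserves F hc)
      (isColimitOfPreserves G hc) α).hom := by
    refine (isColimitOfPreserves F hc).hom_ext fun j => ?_
    rw [IsColimit.comp_coconePointsIsoOfNatIso_hom]
    exact τ.naturality _
  rw [this]
  infer_instance

lemma isIso_app_of_retract {X Y : A} (r : Retract X Y) [IsIso (τ.app Y)] : IsIso (τ.app X) :=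
  ⟨G.map r.i ≫ inv (τ.app Y) ≫ F.map r.r, by
    rw [← τ.naturality_assoc, IsIso.hom_inv_id_assoc, ← F.map_comp, r.retract, F.map_id], by
    simp only [Category.assoc, τ.naturality, IsIso.inv_hom_id_assoc]
    rw [← G.map_comp, r.retract, G.map_id]⟩

lemma isIso_app_of_isZero [HasZeroMorphisms A] [HasZeroMorphisms B] [F.PreservesZeroMorphisms]
    [G.PreservesZeroMorphisms] {X : A} (hX : IsZero X) : IsIso (τ.app X) :=
  (F.map_isZero hX).isIso (G.map_isZero hX) _

end NatTransIso

lemma isIso_app_of_shortExact {A B : Type*} [Category A] [Category B] [Preadditive A] [Abelian B]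
    {F G : A ⥤ B} (τ : F ⟶ G) [F.PreservesZeroMorphisms] [G.PreservesZeroMorphisms]
    [PreservesFiniteLimits F] [PreservesFiniteLimits G] [PreservesFiniteColimits F]
    [PreservesFiniteColimits G] {S : ShortComplex A} (hS : S.ShortExact)
    (h₁ : IsIso (τ.app S.X₁)) (h₃ : IsIso (τ.app S.X₃)) : IsIso (τ.app S.X₂) :=
  ShortComplex.isIso₂_of_shortExact_of_isIso₁₃' (S.mapNatTrans τ) (hS.map_of_exact F)
    (hS.map_of_exact G) h₁ h₃

/-! ### The wide subcategory -/

section Wide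

open ZeroObject

variable {𝕂 : Type u} [Field 𝕂] {κ : KupischFunction}

lemma vanishesBeyond_isClosedUnderLimitsOfShape (J : Type) [Finite J] :
    (VanishesBeyond 𝕂 κ).IsClosedUnderLimitsOfShape (Discrete J) where
  limitsOfShape_le := by
    rintro X ⟨p⟩
    have hlim : ∀ x, IsLimit (((evaluation Circ (ModuleCat.{u} 𝕂)).obj x).mapCone p.cone) :=
      fun x => isLimitOfPreserves _ p.isLimit
    refine ⟨fun x => ?_, fun t y f hf => ?_⟩
    · have := fun j => (p.prop_diag_obj j).1 x
      let L : X.obj x →ₗ[𝕂] ∀ j : Discrete J, (p.diag.obj j).obj x :=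
        LinearMap.pi fun j => ((p.π.app j).app x).hom
      refine Module.Finite.of_injective L fun a b hab => ?_
      exact Concrete.isLimit_ext _ (hlim x) a b fun j => congrFun hab j
    · refine (hlim y).hom_ext fun j => ?_
      change X.map f ≫ (p.π.app j).app y = 0 ≫ (p.π.app j).app y
      have hn : X.map f ≫ (p.π.app j).app y = _ := (p.π.app j).naturality f
      rw [hn, (p.prop_diag_obj j).2 t y f hf, comp_zero, zero_comp]

variable {m : ℕ} (Z : InfinityGon m)

lemma isNakayama_kupisch_eq :
    IsNakayama 𝕂 Z.kupisch = VanishesBeyond 𝕂 Z.kupisch :=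
  isNakayama_eq_vanishesBeyond Z.continuousWithinAt_kupisch

instance : (IsNakayama 𝕂 Z.kupisch).IsClosedUnderSubobjects where
  prop_of_mono i _ h := by
    rw [isNakayama_kupisch_eq] at h ⊢
    exact h.of_mono i

instance : (IsNakayama 𝕂 Z.kupisch).IsClosedUnderQuotients where
  prop_of_epi p _ h := by
    rw [isNakayama_kupisch_eq] at h ⊢
    exact h.of_epi p

instance : (IsNakayama 𝕂 Z.kupisch).IsClosedUnderFiniteProducts where
  isClosedUnderLimitsOfShape J _ := by
    rw [isNakayama_kupisch_eq]
    exact vanishesBeyond_isClosedUnderLimitsOfShape J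

instance : (IsNakayama 𝕂 Z.kupisch).ContainsZero where
  exists_zero := by
    refine ⟨0, isZero_zero _, ?_⟩
    rw [isNakayama_kupisch_eq]
    have h0 := (Functor.isZero_iff (0 : Rep 𝕂)).1 (isZero_zero _)
    refine ⟨fun x => ?_, fun t y f _ => (h0 y).eq_of_tgt _ _⟩
    have := ModuleCat.subsingleton_of_isZero (h0 x)
    infer_instance

variable (𝕂)

/-- Evaluation at a point of the circle, an exact functor on `Rep^pwf(S¹, κ)`. -/
noncomputable def nakayamaEval (x : Circ) : NakayamaRep 𝕂 Z.kupisch ⥤ ModuleCat.{u} 𝕂 :=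
  (IsNakayama 𝕂 Z.kupisch).ι ⋙ (evaluation Circ (ModuleCat.{u} 𝕂)).obj x

/-- The transformation of evaluation functors given by a path. -/
noncomputable def nakayamaEvalMap {x y : Circ} (f : x ⟶ y) :
    nakayamaEval 𝕂 Z x ⟶ nakayamaEval 𝕂 Z y :=
  Functor.whiskerLeft _ ((evaluation Circ (ModuleCat.{u} 𝕂)).map f)

instance : PreservesFiniteLimits (IsNakayama 𝕂 Z.kupisch).ι := by
  have h := (IsNakayama 𝕂 Z.kupisch).preservesKernels_ι
  exact Functor.preservesFiniteLimits_of_preservesKernels _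

instance : PreservesFiniteColimits (IsNakayama 𝕂 Z.kupisch).ι := by
  have h := (IsNakayama 𝕂 Z.kupisch).preservesCokernels_ι
  exact Functor.preservesFiniteColimits_of_preservesCokernels _

instance (x : Circ) : PreservesFiniteLimits (nakayamaEval 𝕂 Z x) :=
  inferInstanceAs (PreservesFiniteLimits (_ ⋙ _))

instance (x : Circ) : PreservesFiniteColimits (nakayamaEval 𝕂 Z x) :=
  inferInstanceAs (PreservesFiniteColimits (_ ⋙ _))

instance (x : Circ) : (nakayamaEval 𝕂 Z x).PreservesZeroMorphisms :=
  inferInstanceAs ((_ ⋙ _).PreservesZeroMorphisms)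

variable {𝕂 Z}

/-- The paths `g_{xy}`, for `(x, y)` in `W`, act on `M` by isomorphisms. -/
def Inverts (W : Set (Circ × Circ)) (M : NakayamaRep 𝕂 Z.kupisch) : Prop :=
  ∀ q ∈ W, IsIso ((nakayamaEvalMap 𝕂 Z (g q.1 q.2)).app M)

/-- The arcs around accumulation points may depend on the representation, but two representations
in `rep(𝒵_m, κ)` admit a common choice. With it, membership is invertibility of a fixed set `W` of
paths. -/
lemma IsDiscreteNakayama.exists_inverts {M N : NakayamaRep 𝕂 Z.kupisch}
    (hM : IsDiscreteNakayama 𝕂 Z M) (hN : IsDiscreteNakayama 𝕂 Z N) :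
    ∃ W : Set (Circ × Circ), Inverts W M ∧ Inverts W N ∧
      ∀ L : NakayamaRep 𝕂 Z.kupisch, Inverts W L → IsDiscreteNakayama 𝕂 Z L := by
  have key : ∀ p : Fin m, ∃ (p₁ p₂ : Fin m) (n₁ n₂ : ℤ),
      CyclicLTLT (cover (Z.pt p₁ n₁)) (cover (Z.acc p.castSucc)) (cover (Z.pt p₂ n₂)) ∧
      ∀ x y : Circ, CyclicLTLELE (cover (Z.pt p₁ n₁)) x y (cover (Z.pt p₂ n₂)) →
        IsIso (M.obj.map (g x y)) ∧ IsIso (N.obj.map (g x y)) := by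
    intro p
    obtain ⟨p₁, p₂, n₁, n₂, h, hiso⟩ := hM.2 p
    obtain ⟨p₁', p₂', n₁', n₂', h', hiso'⟩ := hN.2 p
    obtain ⟨a, ha, b, hb, hab, hxy⟩ := h.exists_nested h'
    obtain ⟨i, k, rfl⟩ : ∃ i k, a = cover (Z.pt i k) := by
      rcases ha with rfl | rfl <;> exact ⟨_, _, rfl⟩
    obtain ⟨j, l, rfl⟩ : ∃ j l, b = cover (Z.pt j l) := by
      rcases hb with rfl | rfl <;> exact ⟨_, _, rfl⟩
    exact ⟨i, j, k, l, hab, fun x y h => ⟨hiso x y (hxy x y h).1, hiso' x y (hxy x y h).2⟩⟩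
  choose p₁ p₂ n₁ n₂ hlt hiso using key
  refine ⟨{q | (∃ (p : Fin m) (n : ℤ),
      CyclicLTLELE (cover (Z.pt p n)) q.1 q.2 (cover (Z.pt p (n + 1)))) ∨
    ∃ p, CyclicLTLELE (cover (Z.pt (p₁ p) (n₁ p))) q.1 q.2 (cover (Z.pt (p₂ p) (n₂ p)))},
    ?_, ?_, fun L hL => ⟨fun p n x y h => hL (x, y) (Or.inl ⟨p, n, h⟩), fun p =>
      ⟨p₁ p, p₂ p, n₁ p, n₂ p, hlt p, fun x y h => hL (x, y) (Or.inr ⟨p, h⟩)⟩⟩⟩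
  · rintro ⟨x, y⟩ (⟨p, n, h⟩ | ⟨p, h⟩)
    · exact hM.1 p n x y h
    · exact (hiso p x y h).1
  · rintro ⟨x, y⟩ (⟨p, n, h⟩ | ⟨p, h⟩)
    · exact hN.1 p n x y h
    · exact (hiso p x y h).2

variable (Z)

/-- Vertices `a` and `b` with `a < p < b` exist for every accumulation point `p`: starting from
`z_{p,1}`, one meets `p` and then `z_{p,0}` before closing the turn. -/
lemma cyclicLTLT_pt_acc_pt (p : Fin m) :
    CyclicLTLT (cover (Z.pt p 1)) (cover (Z.acc p.castSucc)) (cover (Z.pt p 0)) := by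
  have h₀ := Z.acc_lt_pt p 0
  have h₁ : Z.pt p 0 < Z.pt p 1 := Z.pt_strictMono p (by omega)
  have h₂ := Z.pt_lt_acc p 1
  have h₃ : Z.acc p.succ ≤ 2 * Real.pi := by
    rw [← Z.acc_last]
    exact Z.acc_strictMono.monotone (Fin.le_last _)
  have h₄ : 0 ≤ Z.acc p.castSucc := by
    rw [← Z.acc_zero]
    exact Z.acc_strictMono.monotone (Fin.zero_le _)
  have e₁ : arc (cover (Z.pt p 1)) (cover (Z.acc p.castSucc)) =
      Z.acc p.castSucc - Z.pt p 1 + 2 * Real.pi :=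
    arc_eq_of_coe (by linarith) (by linarith) (by simp [cover])
  have e₂ : arc (cover (Z.pt p 1)) (cover (Z.pt p 0)) =
      Z.pt p 0 - Z.pt p 1 + 2 * Real.pi :=
    arc_eq_of_coe (by linarith) (by linarith) (by simp [cover])
  unfold CyclicLTLT
  rw [e₁, e₂]
  constructor <;> linarith

lemma isDiscreteNakayama_of_isZero {M : NakayamaRep 𝕂 Z.kupisch} (hM : IsZero M) :
    IsDiscreteNakayama 𝕂 Z M := by
  have h : ∀ x y, IsIso (M.obj.map (g x y)) := fun x y =>
    isIso_app_of_isZero (nakayamaEvalMap 𝕂 Z (g x y)) hM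
  exact ⟨fun _ _ _ _ _ => h _ _, fun p =>
    ⟨p, p, 1, 0, cyclicLTLT_pt_acc_pt Z p, fun _ _ _ => h _ _⟩⟩

instance : (IsDiscreteNakayama 𝕂 Z).ContainsZero where
  exists_zero := ⟨0, isZero_zero _, isDiscreteNakayama_of_isZero Z (isZero_zero _)⟩

instance : (IsDiscreteNakayama 𝕂 Z).IsStableUnderRetracts where
  of_retract r hY := by
    obtain ⟨W, hW, -, h⟩ := hY.exists_inverts hY
    refine h _ fun q hq => ?_
    have := hW q hq
    exact isIso_app_of_retract _ r

instance : (IsDiscreteNakayama 𝕂 Z).IsClosedUnderKernels where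
  kernels_le := by
    rintro _ ⟨f, k, hk, hX, hY⟩
    obtain ⟨W, hWX, hWY, h⟩ := hX.exists_inverts hY
    refine h _ fun q hq => isIso_app_of_isLimit _ hk ?_
    rintro (_ | _)
    exacts [hWX q hq, hWY q hq]

instance : (IsDiscreteNakayama 𝕂 Z).IsClosedUnderCokernels where
  cokernels_le := by
    rintro _ ⟨f, k, hk, hX, hY⟩
    obtain ⟨W, hWX, hWY, h⟩ := hX.exists_inverts hY
    refine h _ fun q hq => isIso_app_of_isColimit _ hk ?_
    rintro (_ | _)
    exacts [hWX q hq, hWY q hq]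

instance : (IsDiscreteNakayama 𝕂 Z).IsClosedUnderExtensions where
  prop_X₂_of_shortExact hS h₁ h₃ := by
    obtain ⟨W, hW₁, hW₃, h⟩ := h₁.exists_inverts h₃
    exact h _ fun q hq => isIso_app_of_shortExact _ hS (hW₁ q hq) (hW₃ q hq)

instance : (IsDiscreteNakayama 𝕂 Z).IsClosedUnderBinaryProducts where
  limitsOfShape_le := by
    rintro X ⟨p⟩
    obtain ⟨W, hW₁, hW₂, h⟩ := (p.prop_diag_obj ⟨.left⟩).exists_inverts (p.prop_diag_obj ⟨.right⟩)
    refine h _ fun q hq => isIso_app_of_isLimit _ p.isLimit ?_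
    rintro ⟨_ | _⟩
    exacts [hW₁ q hq, hW₂ q hq]

instance : (IsDiscreteNakayama 𝕂 Z).IsClosedUnderFiniteProducts := .mk'

end Wide

end CircleRep

/-- For every field `𝕂` and every `∞`-gon `𝒵_m` with `m ≥ 1`, the category `rep(𝒵_m, κ)` is a wide
subcategory of the abelian category `Rep^pwf(S¹, κ)`, and it is itself abelian. -/
theorem mainTheorem5 {𝕂 : Type*} [Field 𝕂] {m : ℕ} (hm : 0 < m)
    (Z : CircleRep.InfinityGon m) :
    IsWideSubcategory (CircleRep.IsDiscreteNakayama 𝕂 Z) ∧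
      Nonempty (Abelian (CircleRep.IsDiscreteNakayama 𝕂 Z).FullSubcategory) :=
  ⟨{ abelian := ⟨inferInstance⟩
     containsZero := inferInstance
     closedUnderIsomorphisms := inferInstance
     closedUnderFiniteDirectSums := inferInstance
     closedUnderDirectSummands := inferInstance
     closedUnderKernels := inferInstance
     closedUnderCokernels := inferInstance
     closedUnderExtensions := inferInstance }, ⟨inferInstance⟩⟩
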